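/- Let $K$ be a field, $A$ a unital associative $K$-algebra and $P$ a finite poset. A *$P$-multiplicative system* $\mathcal T$ over $A$ is a family of $K$-subspaces $\mathcal T_{i,j}\subseteq A$ ($i\le j$ in $P$) such that $\mathcal T_{i,j}\mathcal T_{j,l}\subseteq\mathcal T_{i,l}$ for $i\le j\le l$, and every $\mathcal T_i=\mathcal T_{i,i}$ is a $K$-algebra with a unit $1_i$ satisfying $1_i r=r=r1_j$ for all $r\in\mathcal T_{i,j}$, $i\le j$. The triple $(P,A,\mathcal T)$ is called an *algebraically equipped poset*. A *representation* of it is a right $A$-module $L$ with $K$-subspaces $L_i\subseteq L$ ($i\in P$) such that $L_i\mathcal T_{i,j}\subseteq L_j$ for $i\le j$ and $a1_i=a$ for $a\in L_i$; a morphism $(L,L_i)\to(M,M_i)$ is an $A$-linear map $h:L\to M$ with $h(L_i)\subseteq M_i$ for all $i$. They form the category $\operatorname{Rep}(P,A,\mathcal T)$. The *incidence algebra* $\Lambda(\mathcal T)=\bigoplus_{i\le j}e_{i,j}\mathcal T_{i,j}$ consists of the $P\times P$ matrices over $A$ with $(i,j)$ entry in $\mathcal T_{i,j}$ for $i\le j$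 and $0$ otherwise, with matrix addition and multiplication and unit $\sum_i e_i$, where $e_i=e_{i,i}1_i$. For a representation $\widetilde L=(L,L_i)$ let $\mathfrak u(\widetilde L)=\bigoplus_i L_i$, a right $\Lambda(\mathcal T)$-module by $(xa)_i=\sum_{j\le i}x_ja_{j,i}$; for a morphism $h$ let $\mathfrak u(h)(x_i)_i=(h(x_i))_i$. Let $P^m=P\cup\{m\}$ be $P$ with a new largest element $m$. If every $\mathcal T_i$ is a subalgebra of $A$ (with the unit of $A$), let $\mathcal T^m$ be the $P^m$-multiplicative system with $\mathcal T^m_{i,j}=\mathcal T_{i,j}$ for $i\le j$ in $P$ and $\mathcal T^m_{i,m}=A$ for all $i\in P^m$. A $P^m$-multiplicative system $\mathcal R$ is *admissible* if every $\mathcal R_i=\mathcal R_{i,i}$ is a division ring, and for all $i\le j<m$ and $0\ne x\in\mathcal R_{i,j}$ there are $l>j$ and $y\in\mathcal R_{j,l}$ with $xy\neq0$. $(P,A,\mathcal T)$ is *extendable with admissible system $\mathcal R$* if $A$ is semisimple (artinian), every $\mathcal T_i$ is a subalgebra of $A$, and there are idempotents $\varepsilon_i\in\mathcal T^m_{i,i}$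 ($i\in P^m$) such that $\varepsilon_mA$ is, up to isomorphism, the only simple right $A$-module, the system $\mathcal R=\{\mathcal R_{i,j}=\varepsilon_i\mathcal T^m_{i,j}\varepsilon_j: i\le j \text{ in } P^m\}$ is admissible, and the $K$-algebras $\Lambda(\mathcal R)$ and $\Lambda(\mathcal T^m)$ are Morita equivalent. Put $\varepsilon=\sum_{i\in P^m}e_i\varepsilon_i\in\Lambda(\mathcal T^m)$, so that $\Lambda(\mathcal R)=\varepsilon\Lambda(\mathcal T^m)\varepsilon$ and, for every right $\Lambda(\mathcal T^m)$-module $M$, $M\varepsilon$ is a right $\Lambda(\mathcal R)$-module. **Theorem.** Let $(P,A,\mathcal T)$ be extendable with admissible system $\mathcal R$. Then the category $\operatorname{Rep}(P,A,\mathcal T)$ is equivalent to the full subcategory $\mathcal U$ of the category of all right $\Lambda(\mathcal R)$-modules whose objects are the socle-projective modules, i.e. the modules whose socle (the sum of all simple submodules) is projective. More precisely, for every representation $(L,L_i:i\in P)$ of $(P,A,\mathcal T)$, with associated representation $\widetilde L=(L,\,L_i:i\in P,\,L_m=L)$ of $(P^m,A,\mathcal T^m)$, the right $\Lambda(\mathcal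 R)$-module $\mathfrak u(\widetilde L)\varepsilon$ is socle-projective, and $(L,L_i)\mapsto\mathfrak u(\widetilde L)\varepsilon$, $h\mapsto\mathfrak u(h)\varepsilon$ (the restriction of $\mathfrak u(h)$) is an equivalence of categories $\operatorname{Rep}(P,A,\mathcal T)\to\mathcal U$. -/

import Mathlib

open CategoryTheory MulOpposite

universe u

set_option linter.unusedSectionVars false

namespace EquippedPoset

/-! Right modules over a ring `A` are modules over `Aᵐᵒᵖ`; the right action `x a` is `op a • x`. -/

/-- A `P`-multiplicative system `R = {R i j ⊆ A : i ≤ j}` of `K`-subspaces of the `K`-algebra `A`.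
The family is extended by `0` to the pairs with `i ≰ j`. The element `one i` is the (unique) unit
of the `K`-algebra `R i i`; it need not be the unit of `A`. The triple `(P, A, R)` is an
algebraically equipped poset. -/
structure MultSystem (K P A : Type u) [Field K] [PartialOrder P] [Ring A] [Algebra K A] where
  space : P → P → Submodule K A
  space_eq_bot : ∀ i j, ¬ i ≤ j → space i j = ⊥
  mul_mem_of_le : ∀ i j l, i ≤ j → j ≤ l →
    ∀ x ∈ space i j, ∀ y ∈ space j l, x * y ∈ space i l
  one : P → A
  one_mem : ∀ i, one i ∈ space i i
  one_mul_of_mem : ∀ i j, i ≤ j → ∀ x ∈ space i j, one i * x = x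
  mul_one_of_mem : ∀ i j, i ≤ j → ∀ x ∈ space i j, x * one j = x

section General

variable {K P A : Type u} [Field K] [PartialOrder P] [Ring A] [Algebra K A]

namespace MultSystem

variable (R : MultSystem K P A)

theorem eq_zero_of_not_le {i j : P} (h : ¬ i ≤ j) {x : A} (hx : x ∈ R.space i j) : x = 0 := by
  rw [R.space_eq_bot i j h] at hx
  exact (Submodule.mem_bot K).1 hx

theorem mul_mem {i j l : P} {x y : A} (hx : x ∈ R.space i j) (hy : y ∈ R.space j l) :
    x * y ∈ R.space i l := by
  by_cases h : i ≤ j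
  · by_cases h' : j ≤ l
    · exact R.mul_mem_of_le i j l h h' x hx y hy
    · rw [R.eq_zero_of_not_le h' hy, mul_zero]
      exact zero_mem _
  · rw [R.eq_zero_of_not_le h hx, zero_mul]
    exact zero_mem _

theorem one_mul_mem {i j : P} {x : A} (hx : x ∈ R.space i j) : R.one i * x = x := by
  by_cases h : i ≤ j
  · exact R.one_mul_of_mem i j h x hx
  · rw [R.eq_zero_of_not_le h hx, mul_zero]

theorem mul_one_mem {i j : P} {x : A} (hx : x ∈ R.space i j) : x * R.one j = x := by
  by_cases h : i ≤ j
  · exact R.mul_one_of_mem i j h x hx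
  · rw [R.eq_zero_of_not_le h hx, zero_mul]

/-- An admissible system on a poset with largest element `⊤`: every `R i i` is a division ring, and
for `j < ⊤` every nonzero `x ∈ R i j` has a nonzero product with some element of some `R j l`,
`l ≠ j`. -/
structure IsAdmissible [OrderTop P] : Prop where
  one_ne_zero : ∀ i, R.one i ≠ 0
  exists_inv : ∀ i, ∀ x ∈ R.space i i, x ≠ 0 →
    ∃ y ∈ R.space i i, x * y = R.one i ∧ y * x = R.one i
  exists_mul_ne_zero : ∀ i j, i ≤ j → j < ⊤ → ∀ x ∈ R.space i j, x ≠ 0 →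
    ∃ l, j ≤ l ∧ l ≠ j ∧ ∃ y ∈ R.space j l, x * y ≠ 0

end MultSystem

/-! ### The category of representations -/

/-- A representation `(L, L i : i ∈ P)`: a right `A`-module `L` with `K`-subspaces `L i` such that
`L i * R i j ⊆ L j` for `i ≤ j`, and `a * 1_i = a` for `a ∈ L i`. -/
structure Rep (R : MultSystem K P A) where
  carrier : Type u
  [addCommGroup : AddCommGroup carrier]
  [moduleField : Module K carrier]
  [moduleRing : Module Aᵐᵒᵖ carrier]
  [isScalarTower : IsScalarTower K Aᵐᵒᵖ carrier]
  sub : P → Submodule K carrier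
  smul_mem : ∀ i j, i ≤ j → ∀ x ∈ sub i, ∀ r ∈ R.space i j, op r • x ∈ sub j
  one_smul : ∀ i, ∀ x ∈ sub i, op (R.one i) • x = x

attribute [instance] Rep.addCommGroup Rep.moduleField Rep.moduleRing Rep.isScalarTower

namespace Rep

variable {R : MultSystem K P A}

theorem smul_mem' (L : Rep R) {i j : P} {x : L.carrier} (hx : x ∈ L.sub i) {r : A}
    (hr : r ∈ R.space i j) : op r • x ∈ L.sub j := by
  by_cases h : i ≤ j
  · exact L.smul_mem i j h x hx r hr
  · rw [R.eq_zero_of_not_le h hr, op_zero, zero_smul]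
    exact zero_mem _

/-- A morphism of representations: an `A`-linear map `h : L → M` with `h (L i) ⊆ M i`. -/
@[ext]
structure Hom (L M : Rep R) where
  toLin : L.carrier →ₗ[Aᵐᵒᵖ] M.carrier
  map_mem : ∀ i, ∀ x ∈ L.sub i, toLin x ∈ M.sub i

instance : Category (Rep R) where
  Hom L M := Hom L M
  id L := ⟨LinearMap.id, fun _ _ hx => hx⟩
  comp f g := ⟨g.toLin.comp f.toLin, fun i x hx => g.map_mem i _ (f.map_mem i x hx)⟩

@[simp] theorem id_toLin (L : Rep R) : Hom.toLin (𝟙 L) = LinearMap.id := rfl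

@[simp] theorem comp_toLin {L M N : Rep R} (f : L ⟶ M) (g : M ⟶ N) :
    Hom.toLin (f ≫ g) = (Hom.toLin g).comp (Hom.toLin f) := rfl

end Rep

/-! ### The incidence algebra of a multiplicative system -/

namespace MultSystem

variable [Fintype P] [DecidableEq P]

/-- The matrices `a` over `A` with `a i j ∈ R i j`, as a (possibly non-unital) subalgebra of the
full matrix algebra. -/
def incSub (R : MultSystem K P A) : NonUnitalSubalgebra K (Matrix P P A) where
  carrier := {a | ∀ i j, a i j ∈ R.space i j}
  zero_mem' := fun _ _ => zero_mem _
  add_mem' := fun ha hb i j => add_mem (ha i j) (hb i j)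
  mul_mem' := fun ha hb i j => by
    rw [Matrix.mul_apply]
    exact sum_mem fun l _ => R.mul_mem (ha i l) (hb l j)
  smul_mem' := fun c _ ha i j => Submodule.smul_mem _ c (ha i j)

/-- The incidence algebra `Λ(R) = ⨁_{i ≤ j} e_{i j} R i j`. -/
def Inc (R : MultSystem K P A) : Type u := R.incSub

variable (R : MultSystem K P A)

instance : NonUnitalRing R.Inc := inferInstanceAs (NonUnitalRing R.incSub)

instance : Module K R.Inc := inferInstanceAs (Module K R.incSub)

/-- The entry `a i j` of `a ∈ Λ(R)`. -/
def Inc.entry {R : MultSystem K P A} (a : R.Inc) : Matrix P P A := a.1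

theorem Inc.entry_mem {R : MultSystem K P A} (a : R.Inc) (i j : P) :
    a.entry i j ∈ R.space i j := a.2 i j

@[ext]
theorem Inc.ext {R : MultSystem K P A} {a b : R.Inc} (h : a.entry = b.entry) : a = b :=
  Subtype.ext h

/-- The unit of `Λ(R)` is `∑ i, e_i`, where `e_i` is the diagonal matrix unit `e_{i i} 1_i`. -/
instance : One R.Inc where
  one := ⟨Matrix.diagonal R.one, fun i j => by
    by_cases h : i = j
    · subst h
      rw [Matrix.diagonal_apply_eq]
      exact R.one_mem i
    · rw [Matrix.diagonal_apply_ne _ h]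
      exact zero_mem _⟩

variable {R}

@[simp] theorem Inc.entry_zero : (0 : R.Inc).entry = 0 := rfl

@[simp] theorem Inc.entry_add (a b : R.Inc) : (a + b).entry = a.entry + b.entry := rfl

@[simp] theorem Inc.entry_mul (a b : R.Inc) : (a * b).entry = a.entry * b.entry := rfl

@[simp] theorem Inc.entry_smul (c : K) (a : R.Inc) : (c • a).entry = c • a.entry := rfl

@[simp] theorem Inc.entry_one : (1 : R.Inc).entry = Matrix.diagonal R.one := rfl

variable (R)

instance : Ring R.Inc :=
  { (inferInstance : NonUnitalRing R.Inc), (inferInstance : One R.Inc) with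
    one_mul := fun a => by
      ext i j
      rw [Inc.entry_mul, Inc.entry_one, Matrix.diagonal_mul]
      exact R.one_mul_mem (a.entry_mem i j)
    mul_one := fun a => by
      ext i j
      rw [Inc.entry_mul, Inc.entry_one, Matrix.mul_diagonal]
      exact R.mul_one_mem (a.entry_mem i j) }

instance : Algebra K R.Inc :=
  Algebra.ofModule
    (fun c a b => Inc.ext (by
      change (c • a.entry) * b.entry = c • (a.entry * b.entry)
      exact smul_mul_assoc _ _ _))
    (fun c a b => Inc.ext (by
      change a.entry * (c • b.entry) = c • (a.entry * b.entry)
      exact mul_smul_comm _ _ _))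

end MultSystem

/-! ### The functor `𝔲` from representations to right modules over the incidence algebra -/

section U

variable [Fintype P] [DecidableEq P] {R : MultSystem K P A}

/-- The underlying group `⨁ i, L i` of the right `Λ(R)`-module `𝔲(L)`. -/
def Rep.U (L : Rep R) : Type u := ∀ i, L.sub i

instance (L : Rep R) : AddCommGroup L.U := inferInstanceAs (AddCommGroup (∀ i, L.sub i))

/-- The `i`-th component of an element of `𝔲(L)`, as an element of `L`. -/
def Rep.U.comp {L : Rep R} (x : L.U) (i : P) : L.carrier := (x i).1

theorem Rep.U.comp_mem {L : Rep R} (x : L.U) (i : P) : x.comp i ∈ L.sub i := (x i).2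

@[ext]
theorem Rep.U.ext {L : Rep R} {x y : L.U} (h : ∀ i, x.comp i = y.comp i) : x = y :=
  funext fun i => Subtype.ext (h i)

@[simp] theorem Rep.U.comp_zero {L : Rep R} (i : P) : (0 : L.U).comp i = 0 := rfl

@[simp] theorem Rep.U.comp_add {L : Rep R} (x y : L.U) (i : P) :
    (x + y).comp i = x.comp i + y.comp i := rfl

/-- The right action of `Λ(R)` on `𝔲(L)`: the `i`-th component of `x a` is `∑ j, x_j a_{j i}`. -/
instance (L : Rep R) : SMul (R.Inc)ᵐᵒᵖ L.U where
  smul a x := fun i => ⟨∑ j, op (a.unop.entry j i) • x.comp j,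
    sum_mem fun j _ => L.smul_mem' (x.comp_mem j) (a.unop.entry_mem j i)⟩

theorem Rep.U.comp_smul {L : Rep R} (a : (R.Inc)ᵐᵒᵖ) (x : L.U) (i : P) :
    (a • x).comp i = ∑ j, op (a.unop.entry j i) • x.comp j := rfl

instance (L : Rep R) : Module (R.Inc)ᵐᵒᵖ L.U where
  one_smul x := by
    ext i
    rw [Rep.U.comp_smul, Finset.sum_eq_single i]
    · rw [unop_one, MultSystem.Inc.entry_one, Matrix.diagonal_apply_eq]
      exact L.one_smul i _ (x.comp_mem i)
    · intro j _ hj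
      rw [unop_one, MultSystem.Inc.entry_one, Matrix.diagonal_apply_ne _ hj, op_zero, zero_smul]
    · intro h
      exact absurd (Finset.mem_univ i) h
  mul_smul a b x := by
    ext i
    simp only [Rep.U.comp_smul, unop_mul, MultSystem.Inc.entry_mul, Matrix.mul_apply,
      Finset.op_sum, op_mul, Finset.sum_smul, Finset.smul_sum, mul_smul]
    exact Finset.sum_comm
  smul_zero a := by
    ext i
    simp [Rep.U.comp_smul]
  smul_add a x y := by
    ext i
    simp [Rep.U.comp_smul, Finset.sum_add_distrib]
  add_smul a b x := by
    ext i
    simp [Rep.U.comp_smul, Finset.sum_add_distrib, add_smul]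
  zero_smul x := by
    ext i
    simp [Rep.U.comp_smul]

/-- `𝔲(h) (x_i)_i = (h x_i)_i`. -/
def Rep.uMap {L M : Rep R} (h : L ⟶ M) : L.U →ₗ[(R.Inc)ᵐᵒᵖ] M.U where
  toFun x := fun i => ⟨Rep.Hom.toLin h (x.comp i), Rep.Hom.map_mem h i _ (x.comp_mem i)⟩
  map_add' x y := by
    ext i
    exact map_add (Rep.Hom.toLin h) (x.comp i) (y.comp i)
  map_smul' a x := by
    ext i
    change Rep.Hom.toLin h (∑ j, op (a.unop.entry j i) • x.comp j)
      = ∑ j, op (a.unop.entry j i) • Rep.Hom.toLin h (x.comp j)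
    rw [map_sum]
    exact Finset.sum_congr rfl fun j _ => map_smul _ _ _

/-- The functor `𝔲 : Rep(P, A, R) ⥤ Mod-Λ(R)`. -/
def uFunctor (R : MultSystem K P A) : Rep R ⥤ ModuleCat.{u} (R.Inc)ᵐᵒᵖ where
  obj L := ModuleCat.of _ L.U
  map h := ModuleCat.ofHom (Rep.uMap h)
  map_id _ := rfl
  map_comp _ _ := rfl

end U

/-! ### Adding a largest point -/

namespace MultSystem

/-- The spaces of the system `T^m` on `P^m = WithTop P`: those of `T` on `P`, and `T i m = A` for
all `i ∈ P^m`. -/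
def topSpace (T : MultSystem K P A) : WithTop P → WithTop P → Submodule K A
  | _, none => ⊤
  | none, some _ => ⊥
  | some i, some j => T.space i j

/-- The system `T^m` on `P^m`. It is defined when every `T i i` contains the unit of `A`, that is,
when every `T i i` is a (unital) subalgebra of `A`. -/
def extend (T : MultSystem K P A) (hT : ∀ i, (1 : A) ∈ T.space i i) :
    MultSystem K (WithTop P) A where
  space := T.topSpace
  space_eq_bot i j h := by
    rcases i with _ | i <;> rcases j with _ | j
    · exact absurd le_rfl h
    · rfl
    · exact absurd le_top h
    · exact T.space_eq_bot i j fun h' => h (WithTop.coe_le_coe.2 h')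
  mul_mem_of_le i j l hij hjl x hx y hy := by
    rcases l with _ | l
    · exact Submodule.mem_top
    · rcases j with _ | j
      · have : y = 0 := (Submodule.mem_bot K).1 hy
        rw [this, mul_zero]
        exact zero_mem _
      · rcases i with _ | i
        · have : x = 0 := (Submodule.mem_bot K).1 hx
          rw [this, zero_mul]
          exact zero_mem _
        · exact T.mul_mem hx hy
  one _ := 1
  one_mem i := by
    rcases i with _ | i
    · exact Submodule.mem_top
    · exact hT i
  one_mul_of_mem _ _ _ x _ := one_mul x
  mul_one_of_mem _ _ _ x _ := mul_one x

theorem one_eq_one (T : MultSystem K P A) (hT : ∀ i, (1 : A) ∈ T.space i i) (i : P) :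
    T.one i = 1 := by
  rw [← T.one_mul_of_mem i i le_rfl 1 (hT i), mul_one]

end MultSystem

/-- The functor `Rep(P, A, T) ⥤ Rep(P^m, A, T^m)` that sends `(L, L i : i ∈ P)` to
`(L, L i : i ∈ P, L)`, i.e. puts `L_m = L`. -/
def topFunctor (T : MultSystem K P A) (hT : ∀ i, (1 : A) ∈ T.space i i) :
    Rep T ⥤ Rep (T.extend hT) where
  obj L :=
    { carrier := L.carrier
      sub := fun i => match i with
        | none => ⊤
        | some i => L.sub i
      smul_mem := fun i j _ x hx r hr => by
        rcases j with _ | j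
        · exact Submodule.mem_top
        · rcases i with _ | i
          · have : r = 0 := (Submodule.mem_bot K).1 hr
            rw [this, op_zero, zero_smul]
            exact zero_mem _
          · exact L.smul_mem' hx hr
      one_smul := fun _ x _ => _root_.one_smul Aᵐᵒᵖ x }
  map h := ⟨Rep.Hom.toLin (R := T) h, fun i x hx => by
    rcases i with _ | i
    · exact Submodule.mem_top
    · exact Rep.Hom.map_mem (R := T) h i x hx⟩
  map_id _ := rfl
  map_comp _ _ := rfl

/-! ### Cutting down by idempotents -/

namespace MultSystem

/-- For idempotents `ε i ∈ T i i`, the system of the spaces `ε i * T i j * ε j`. -/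
def corner (T : MultSystem K P A) (ε : P → A) (hε : ∀ i, IsIdempotentElem (ε i))
    (hmem : ∀ i, ε i ∈ T.space i i) : MultSystem K P A where
  space i j := (T.space i j).map ((LinearMap.mulLeft K (ε i)).comp (LinearMap.mulRight K (ε j)))
  space_eq_bot i j h := by rw [T.space_eq_bot i j h, Submodule.map_bot]
  mul_mem_of_le i j l _ _ x hx y hy := by
    obtain ⟨a, ha, rfl⟩ := hx
    obtain ⟨b, hb, rfl⟩ := hy
    refine ⟨a * ε j * (ε j * b), T.mul_mem (T.mul_mem ha (hmem j)) (T.mul_mem (hmem j) hb), ?_⟩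
    simp only [LinearMap.comp_apply, LinearMap.mulLeft_apply, LinearMap.mulRight_apply, mul_assoc]
  one := ε
  one_mem i := ⟨ε i, hmem i, by
    simp only [LinearMap.comp_apply, LinearMap.mulLeft_apply, LinearMap.mulRight_apply,
      (hε i).eq]⟩
  one_mul_of_mem i j _ x hx := by
    obtain ⟨a, _, rfl⟩ := hx
    simp only [LinearMap.comp_apply, LinearMap.mulLeft_apply, LinearMap.mulRight_apply]
    rw [← mul_assoc, (hε i).eq]
  mul_one_of_mem i j _ x hx := by
    obtain ⟨a, _, rfl⟩ := hx
    simp only [LinearMap.comp_apply, LinearMap.mulLeft_apply, LinearMap.mulRight_apply, mul_assoc,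
      (hε j).eq]

theorem mem_corner {T : MultSystem K P A} {ε : P → A} {hε : ∀ i, IsIdempotentElem (ε i)}
    {hmem : ∀ i, ε i ∈ T.space i i} {i j : P} {x : A} :
    x ∈ (T.corner ε hε hmem).space i j ↔ ∃ t ∈ T.space i j, ε i * t * ε j = x := by
  constructor
  · rintro ⟨t, ht, rfl⟩
    exact ⟨t, ht, mul_assoc _ _ _⟩
  · rintro ⟨t, ht, rfl⟩
    exact ⟨t, ht, (mul_assoc _ _ _).symm⟩

variable [Fintype P] [DecidableEq P]

/-- The inclusion of `Λ(R) = ε Λ(T) ε` in `Λ(T)`, where `R i j = ε i * T i j * ε j`. It maps the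
unit of `Λ(R)` to the idempotent `ε = ∑ i, e_i ε_i`, the diagonal matrix with entries `ε i`. -/
def cornerIncl (T : MultSystem K P A) (ε : P → A) (hε : ∀ i, IsIdempotentElem (ε i))
    (hmem : ∀ i, ε i ∈ T.space i i) : (T.corner ε hε hmem).Inc →ₙ+* T.Inc where
  toFun a := ⟨a.entry, fun i j => by
    obtain ⟨t, ht, h⟩ := mem_corner.1 (a.entry_mem i j)
    rw [← h]
    exact T.mul_mem (T.mul_mem (hmem i) ht) (hmem j)⟩
  map_mul' _ _ := rfl
  map_zero' := rfl
  map_add' _ _ := rfl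

theorem entry_cornerIncl_one (T : MultSystem K P A) (ε : P → A)
    (hε : ∀ i, IsIdempotentElem (ε i)) (hmem : ∀ i, ε i ∈ T.space i i) :
    (T.cornerIncl ε hε hmem 1).entry = Matrix.diagonal ε := rfl

/-- The image of `Λ(R)` in `Λ(T)` is `ε Λ(T) ε`. -/
theorem range_cornerIncl (T : MultSystem K P A) (ε : P → A)
    (hε : ∀ i, IsIdempotentElem (ε i)) (hmem : ∀ i, ε i ∈ T.space i i) :
    Set.range (T.cornerIncl ε hε hmem)
      = {b | ∃ a : T.Inc, T.cornerIncl ε hε hmem 1 * a * T.cornerIncl ε hε hmem 1 = b} := by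
  ext b
  constructor
  · rintro ⟨a, rfl⟩
    exact ⟨T.cornerIncl ε hε hmem a, by rw [← map_mul, ← map_mul, one_mul, mul_one]⟩
  · rintro ⟨a, rfl⟩
    refine ⟨⟨fun i j => ε i * a.entry i j * ε j, fun i j =>
      mem_corner.2 ⟨_, a.entry_mem i j, rfl⟩⟩, ?_⟩
    ext i j
    change ε i * a.entry i j * ε j = (Matrix.diagonal ε * a.entry * Matrix.diagonal ε) i j
    rw [Matrix.mul_diagonal, Matrix.diagonal_mul]

end MultSystem

end General

section Cut

variable {B C : Type u} [Ring B] [Ring C]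

/-- For a right `C`-module `M` and a multiplicative additive map `f : B → C` (not necessarily
preserving the unit) with `ε = f 1`, the subgroup `M ε` of `M`. -/
def cutSubgroup (f : B →ₙ+* C) (M : Type u) [AddCommGroup M] [Module Cᵐᵒᵖ M] : AddSubgroup M :=
  (DistribSMul.toAddMonoidHom M (op (f 1))).range

theorem op_smul_mem_cutSubgroup (f : B →ₙ+* C) {M : Type u} [AddCommGroup M] [Module Cᵐᵒᵖ M]
    (b : B) (x : M) : op (f b) • x ∈ cutSubgroup f M :=
  ⟨op (f b) • x, by
    change op (f 1) • op (f b) • x = op (f b) • x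
    rw [← mul_smul, ← op_mul, ← map_mul, mul_one]⟩

/-- `M ε` is a right `B`-module through `f`. -/
instance (f : B →ₙ+* C) (M : Type u) [AddCommGroup M] [Module Cᵐᵒᵖ M] :
    SMul Bᵐᵒᵖ (cutSubgroup f M) where
  smul b x := ⟨op (f b.unop) • x.1, op_smul_mem_cutSubgroup f b.unop x.1⟩

theorem coe_cut_smul (f : B →ₙ+* C) {M : Type u} [AddCommGroup M] [Module Cᵐᵒᵖ M]
    (b : Bᵐᵒᵖ) (x : cutSubgroup f M) : ((b • x : cutSubgroup f M) : M) = op (f b.unop) • x.1 := rfl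

instance (f : B →ₙ+* C) (M : Type u) [AddCommGroup M] [Module Cᵐᵒᵖ M] :
    Module Bᵐᵒᵖ (cutSubgroup f M) where
  one_smul x := by
    obtain ⟨_, y, rfl⟩ := x
    apply Subtype.ext
    change op (f 1) • op (f 1) • y = op (f 1) • y
    rw [← mul_smul, ← op_mul, ← map_mul, mul_one]
  mul_smul a b x := by
    apply Subtype.ext
    simp only [coe_cut_smul, unop_mul, map_mul, op_mul, mul_smul]
  smul_zero a := Subtype.ext (smul_zero (op (f a.unop)))
  smul_add a x y := Subtype.ext (smul_add (op (f a.unop)) x.1 y.1)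
  add_smul a b x := by
    apply Subtype.ext
    change op (f (a.unop + b.unop)) • x.1 = op (f a.unop) • x.1 + op (f b.unop) • x.1
    rw [map_add, MulOpposite.op_add, add_smul]
  zero_smul x := by
    apply Subtype.ext
    simp only [coe_cut_smul, unop_zero, map_zero, op_zero, zero_smul, AddSubgroup.coe_zero]

/-- The restriction of a `C`-linear map `g : M → N` to `M ε → N ε`. -/
def cutMap (f : B →ₙ+* C) {M N : Type u} [AddCommGroup M] [Module Cᵐᵒᵖ M] [AddCommGroup N]
    [Module Cᵐᵒᵖ N] (g : M →ₗ[Cᵐᵒᵖ] N) : cutSubgroup f M →ₗ[Bᵐᵒᵖ] cutSubgroup f N where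
  toFun x := ⟨g x.1, by
    obtain ⟨_, y, rfl⟩ := x
    exact ⟨g y, (map_smul g (op (f 1)) y).symm⟩⟩
  map_add' x y := Subtype.ext (map_add g x.1 y.1)
  map_smul' b x := Subtype.ext (map_smul g (op (f b.unop)) x.1)

/-- The functor `Mod-C ⥤ Mod-B`, `M ↦ M ε`. -/
def cutFunctor (f : B →ₙ+* C) : ModuleCat.{u} Cᵐᵒᵖ ⥤ ModuleCat.{u} Bᵐᵒᵖ where
  obj M := ModuleCat.of _ (cutSubgroup f M)
  map g := ModuleCat.ofHom (cutMap f g.hom)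
  map_id _ := rfl
  map_comp _ _ := rfl

/-- The socle of a module: the sum of its simple submodules. -/
def socle (S M : Type u) [Ring S] [AddCommGroup M] [Module S M] : Submodule S M :=
  sSup {N : Submodule S M | IsSimpleModule S N}

/-- The property of a right `B`-module to have a projective socle. -/
def socleProjective (B : Type u) [Ring B] : ObjectProperty (ModuleCat.{u} Bᵐᵒᵖ) :=
  fun M => Module.Projective Bᵐᵒᵖ (socle Bᵐᵒᵖ M)

end Cut

section Extendable

variable {K P A : Type u} [Field K] [PartialOrder P] [Fintype P] [DecidableEq P] [Ring A]
  [Algebra K A]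

/-- `(P, A, T)` is extendable by means of the elements `ε i`, `i ∈ P^m`, with admissible system
`R i j = ε i * T i j * ε j`, `i ≤ j` in `P^m`. -/
structure IsExtendable (T : MultSystem K P A) (ε : WithTop P → A) : Prop where
  /-- `A` is a semisimple algebra. -/
  semisimple : IsSemisimpleRing A
  /-- The right ideal `ε_m A` is a simple right `A`-module. -/
  simple : IsSimpleModule Aᵐᵒᵖ (Submodule.span Aᵐᵒᵖ {ε ⊤})
  /-- Up to isomorphism, `ε_m A` is the only simple right `A`-module. -/
  simple_unique : ∀ (S : Type u) [AddCommGroup S] [Module Aᵐᵒᵖ S], IsSimpleModule Aᵐᵒᵖ S →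
    Nonempty (S ≃ₗ[Aᵐᵒᵖ] Submodule.span Aᵐᵒᵖ {ε ⊤})
  /-- Every `T i i` is a (unital) subalgebra of `A`. -/
  one_mem : ∀ i, (1 : A) ∈ T.space i i
  /-- The `ε i` are idempotents. -/
  idem : ∀ i, IsIdempotentElem (ε i)
  /-- `ε i` lies in `T i i` (where `T m m = A`). -/
  mem : ∀ i, ε i ∈ (T.extend one_mem).space i i
  /-- `R` is an admissible system. -/
  admissible : ((T.extend one_mem).corner ε idem mem).IsAdmissible
  /-- `Λ(T^m)` and `Λ(R)` are Morita equivalent (the right module categories are equivalent). -/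
  morita : IsMoritaEquivalent K ((T.extend one_mem).Inc)ᵐᵒᵖ
    (((T.extend one_mem).corner ε idem mem).Inc)ᵐᵒᵖ

namespace IsExtendable

variable {T : MultSystem K P A} {ε : WithTop P → A}

/-- The system `T^m` on `P^m`. -/
abbrev topSystem (h : IsExtendable T ε) : MultSystem K (WithTop P) A := T.extend h.one_mem

/-- The admissible system `R i j = ε i * T i j * ε j` on `P^m`. -/
abbrev admissibleSystem (h : IsExtendable T ε) : MultSystem K (WithTop P) A :=
  h.topSystem.corner ε h.idem h.mem

/-- The functor `Rep(P, A, T) ⥤ Mod-Λ(R)` that sends `(L, L i : i ∈ P)` to `𝔲(L') ε`, where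
`L' = (L, L i : i ∈ P, L)` is the associated representation of `(P^m, A, T^m)`. -/
def functor (h : IsExtendable T ε) : Rep T ⥤ ModuleCat.{u} (h.admissibleSystem.Inc)ᵐᵒᵖ :=
  topFunctor T h.one_mem ⋙ uFunctor h.topSystem ⋙
    cutFunctor (h.topSystem.cornerIncl ε h.idem h.mem)

end IsExtendable

end Extendable

end EquippedPoset

/-! Two facts carry the proof: over `Λ(R)` a projective socle is a separation condition at the
largest point, and the Morita equivalence forces every `ε i` to be a full idempotent of its diagonal
algebra.

For the first, take a point `j` maximal in the support of a nonzero `Λ(R)`-module. A nonzero `y = y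
e_j` is then annihilated by all off-diagonal entries of row `j`, and since `R j j` is a division
ring, the module `y Λ(R)` is simple with isomorphism type determined by `j`. So there is at most one
simple module per point. The one at `⊤` is isomorphic to `e_⊤ Λ(R)`, hence projective; one at `j <
⊤` is not, by admissibility. Thus the socle is projective exactly when no nonzero element is
annihilated by all `R i ⊤` (`TopSeparated.projective_socle`, `topSeparated_of_projective_socle`).

For the second, count simple modules. For each point `j`, `Λ(T^m)` has a simple module on which `e_j
ε_j` acts nontrivially and the other `e_i ε_i` act as zero. If the ideal generated by the `e_i ε_i`
were proper, a further simple module would be annihilated by all of them, giving more simple modules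
than `Λ(R)` has. The ideal is therefore everything, and diagonal entries of an expression for `1`
give `1 = ∑ a_k ε_j b_k` in each diagonal algebra (`exists_sum_mul_mul_eq_one`).

Fullness of `ε ⊤` in `A` lets a morphism be reconstructed from its restriction to `L ε_⊤`, and
fullness of `ε i` controls its effect on `L i`; this gives faithfulness and fullness of the functor.
For essential surjectivity, a module `X` is coinduced to the representation of `R ⊤ ⊤`-linear maps
from `A ε_⊤` to `X`. The canonical map from `X` to the cut of this representation is always onto,
and it is injective when `X` is separated at `⊤`. -/

namespace EquippedPoset

namespace MultSystem

variable {K P A : Type u} [Field K] [PartialOrder P] [Fintype P] [DecidableEq P] [Ring A]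
  [Algebra K A] {R : MultSystem K P A}

/-! ### Matrix units in an incidence algebra. -/

namespace Inc

theorem entry_sum {ι : Type*} (s : Finset ι) (f : ι → R.Inc) :
    (∑ k ∈ s, f k).entry = ∑ k ∈ s, (f k).entry :=
  map_sum (⟨⟨entry, entry_zero⟩, entry_add⟩ : R.Inc →+ Matrix P P A) f s

/-- The matrix with the single entry `r ∈ R i j`, at the place `(i, j)`. -/
def single (i j : P) (r : A) (hr : r ∈ R.space i j) : R.Inc :=
  ⟨Matrix.single i j r, fun k l => by
    by_cases h : i = k ∧ j = l
    · obtain ⟨rfl, rfl⟩ := h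
      rwa [Matrix.single_apply_same]
    · rw [Matrix.single_apply_of_ne _ _ _ _ _ h]
      exact zero_mem _⟩

@[simp] theorem entry_single (i j : P) (r : A) (hr : r ∈ R.space i j) :
    (single i j r hr).entry = Matrix.single i j r := rfl

theorem single_congr {i j : P} {r s : A} (hr : r ∈ R.space i j) (h : r = s) :
    single i j r hr = single i j s (h ▸ hr) := by
  subst h; rfl

theorem single_zero (i j : P) : single i j 0 (zero_mem (R.space i j)) = 0 := by
  ext
  simp

theorem single_add (i j : P) (r s : A) (hr : r ∈ R.space i j) (hs : s ∈ R.space i j) :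
    single i j (r + s) (add_mem hr hs) = single i j r hr + single i j s hs := by
  ext
  simp [Matrix.single_add]

theorem single_mul_single {i j l : P} {r s : A} (hr : r ∈ R.space i j) (hs : s ∈ R.space j l) :
    single i j r hr * single j l s hs = single i l (r * s) (R.mul_mem hr hs) := by
  ext
  simp

theorem single_mul_single_of_ne {i j k l : P} (h : j ≠ k) {r s : A} (hr : r ∈ R.space i j)
    (hs : s ∈ R.space k l) : single i j r hr * single k l s hs = 0 := by
  ext
  simp [h]

theorem eq_sum_single (a : R.Inc) :
    a = ∑ i, ∑ j, single i j (a.entry i j) (a.entry_mem i j) := by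
  ext i j
  simp only [entry_sum, entry_single]
  rw [← Matrix.matrix_eq_sum_single]

theorem one_eq_sum_single : (1 : R.Inc) = ∑ i, single i i (R.one i) (R.one_mem i) := by
  ext i j
  simp only [entry_sum, entry_single, entry_one, Matrix.sum_apply, Matrix.single_apply,
    Matrix.diagonal_apply]
  rcases eq_or_ne i j with rfl | h
  · simp
  · rw [if_neg h, Finset.sum_eq_zero]
    rintro k -
    rw [if_neg]
    rintro ⟨rfl, rfl⟩
    exact h rfl

theorem single_one_mul (i : P) (a : R.Inc) :
    single i i (R.one i) (R.one_mem i) * a = ∑ j, single i j (a.entry i j) (a.entry_mem i j) := by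
  conv_lhs => rw [eq_sum_single a]
  rw [Finset.mul_sum, Finset.sum_eq_single i]
  · rw [Finset.mul_sum]
    refine Finset.sum_congr rfl fun j _ => ?_
    rw [single_mul_single]
    exact single_congr _ (R.one_mul_mem (a.entry_mem i j))
  · intro k _ hk
    rw [Finset.mul_sum]
    exact Finset.sum_eq_zero fun j _ => single_mul_single_of_ne hk.symm _ _
  · intro h
    exact absurd (Finset.mem_univ i) h

theorem mul_single (a : R.Inc) {j l : P} {r : A} (hr : r ∈ R.space j l) :
    a * single j l r hr = ∑ i, single i l (a.entry i j * r) (R.mul_mem (a.entry_mem i j) hr) := by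
  conv_lhs => rw [eq_sum_single a]
  rw [Finset.sum_mul]
  refine Finset.sum_congr rfl fun i _ => ?_
  rw [Finset.sum_mul, Finset.sum_eq_single j]
  · rw [single_mul_single]
  · intro k _ hk
    exact single_mul_single_of_ne hk _ _
  · intro h
    exact absurd (Finset.mem_univ j) h

/-- A nonzero term through `j` needs `i ≤ j ≤ i`. Taking a diagonal entry is thus multiplicative,
which transfers identities from the incidence algebra to `R i i`. -/
theorem entry_mul_self (a b : R.Inc) (i : P) :
    (a * b).entry i i = a.entry i i * b.entry i i := by
  rw [entry_mul, Matrix.mul_apply, Finset.sum_eq_single i]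
  · intro j _ hj
    by_cases h : i ≤ j
    · rw [R.eq_zero_of_not_le (fun h' => hj (le_antisymm h' h)) (b.entry_mem j i), mul_zero]
    · rw [R.eq_zero_of_not_le h (a.entry_mem i j), zero_mul]
  · intro h
    exact absurd (Finset.mem_univ i) h

end Inc

/-! ### Elements annihilated by the entries off the diagonal -/

section Peripheral

variable {X Z : Type u} [AddCommGroup X] [Module (R.Inc)ᵐᵒᵖ X] [AddCommGroup Z]
  [Module (R.Inc)ᵐᵒᵖ Z]

theorem smul_single_smul_single {i j l : P} {r s : A} (hr : r ∈ R.space i j)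
    (hs : s ∈ R.space j l) (x : X) :
    op (Inc.single j l s hs) • op (Inc.single i j r hr) • x
      = op (Inc.single i l (r * s) (R.mul_mem hr hs)) • x := by
  rw [← mul_smul, ← op_mul, Inc.single_mul_single]

theorem smul_single_smul_single_of_ne {i j k l : P} (h : j ≠ k) {r s : A} (hr : r ∈ R.space i j)
    (hs : s ∈ R.space k l) (x : X) :
    op (Inc.single k l s hs) • op (Inc.single i j r hr) • x = 0 := by
  rw [← mul_smul, ← op_mul, Inc.single_mul_single_of_ne h, op_zero, zero_smul]

theorem sum_single_one_smul (x : X) :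
    ∑ i, op (Inc.single i i (R.one i) (R.one_mem i)) • x = x := by
  rw [← Finset.sum_smul, ← Finset.op_sum, ← Inc.one_eq_sum_single, op_one, one_smul]

theorem smul_eq_sum_of_single_smul_eq {i : P} {x : X}
    (hx : op (Inc.single i i (R.one i) (R.one_mem i)) • x = x) (a : (R.Inc)ᵐᵒᵖ) :
    a • x = ∑ j, op (Inc.single i j (a.unop.entry i j) (a.unop.entry_mem i j)) • x := by
  conv_lhs => rw [← hx, ← op_unop a, ← mul_smul, ← op_mul, Inc.single_one_mul, Finset.op_sum,
    Finset.sum_smul]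

/-- `y = y e_j`, and `y` is annihilated by all `R j l` with `l ≠ j`. -/
def IsPeripheral (j : P) (y : X) : Prop :=
  op (Inc.single j j (R.one j) (R.one_mem j)) • y = y ∧
    ∀ l, l ≠ j → ∀ r hr, op (Inc.single (R := R) j l r hr) • y = 0

theorem IsPeripheral.smul_eq {j : P} {y : X} (hy : R.IsPeripheral j y) (a : (R.Inc)ᵐᵒᵖ) :
    a • y = op (Inc.single j j (a.unop.entry j j) (a.unop.entry_mem j j)) • y := by
  rw [smul_eq_sum_of_single_smul_eq hy.1, Finset.sum_eq_single j]
  · intro l _ hl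
    exact hy.2 l hl _ _
  · intro h
    exact absurd (Finset.mem_univ j) h

theorem exists_isPeripheral [Nontrivial X] : ∃ (j : P) (y : X), y ≠ 0 ∧ R.IsPeripheral j y := by
  classical
  let s : Finset P := Finset.univ.filter fun j =>
    ∃ y : X, y ≠ 0 ∧ op (Inc.single j j (R.one j) (R.one_mem j)) • y = y
  have key : ∀ (j : P) (y : X), op (Inc.single j j (R.one j) (R.one_mem j)) • y ≠ 0 → j ∈ s := by
    intro j y hy
    refine Finset.mem_filter.2 ⟨Finset.mem_univ j, _, hy, ?_⟩
    rw [smul_single_smul_single]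
    congr 2
    exact Inc.single_congr _ (R.one_mul_mem (R.one_mem j))
  have hs : s.Nonempty := by
    obtain ⟨x, hx⟩ := exists_ne (0 : X)
    by_contra hs
    apply hx
    rw [← sum_single_one_smul (R := R) x]
    exact Finset.sum_eq_zero fun j _ => by_contra fun hj => hs ⟨j, key j x hj⟩
  -- `s` is the support of `X`. With `j` maximal in it, a nonzero `y r` with `r ∈ R j l` would put
  -- `l` in the support too, so `l = j`.
  obtain ⟨j, hj⟩ := s.exists_maximal hs
  obtain ⟨y, hy, hjy⟩ := (Finset.mem_filter.1 hj.1).2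
  refine ⟨j, y, hy, hjy, fun l hl r hr => ?_⟩
  by_contra hne
  by_cases hle : j ≤ l
  · have hls : l ∈ s := by
      refine key l (op (Inc.single j l r hr) • y) ?_
      rw [smul_single_smul_single, Inc.single_congr _ (R.mul_one_mem hr)]
      exact hne
    exact hl (le_antisymm (hj.2 hls hle) hle)
  · apply hne
    rw [Inc.single_congr hr (R.eq_zero_of_not_le hle hr), Inc.single_zero, op_zero, zero_smul]

variable [OrderTop P]

theorem isPeripheral_top {y : X}
    (hy : op (Inc.single ⊤ ⊤ (R.one ⊤) (R.one_mem ⊤)) • y = y) : R.IsPeripheral ⊤ y :=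
  ⟨hy, fun l hl r hr => by
    rw [Inc.single_congr hr (R.eq_zero_of_not_le (fun h => hl (top_le_iff.1 h)) hr),
      Inc.single_zero, op_zero, zero_smul]⟩

namespace IsPeripheral

variable {j : P} {y : X} {z : Z}

theorem exists_smul_smul_eq (hR : R.IsAdmissible) (hy : R.IsPeripheral j y) (a : (R.Inc)ᵐᵒᵖ)
    (ha : a.unop.entry j j ≠ 0) : ∃ b : (R.Inc)ᵐᵒᵖ, b • a • y = y := by
  obtain ⟨s, hs, h, -⟩ := hR.exists_inv j _ (a.unop.entry_mem j j) ha
  refine ⟨op (Inc.single j j s hs), ?_⟩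
  rw [hy.smul_eq a, smul_single_smul_single, Inc.single_congr _ h, hy.1]

/-- Only the diagonal entry at `j` acts on `y`, and a nonzero one is invertible. The annihilator
therefore depends on `j` alone. -/
theorem smul_eq_zero_iff (hR : R.IsAdmissible) (hy : R.IsPeripheral j y) (hy0 : y ≠ 0)
    (a : (R.Inc)ᵐᵒᵖ) : a • y = 0 ↔ a.unop.entry j j = 0 := by
  constructor
  · intro h
    by_contra ha
    obtain ⟨b, hb⟩ := hy.exists_smul_smul_eq hR a ha
    rw [h, smul_zero] at hb
    exact hy0 hb.symm
  · intro h
    rw [hy.smul_eq a, Inc.single_congr _ h, Inc.single_zero, op_zero, zero_smul]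

theorem isSimpleModule_span (hR : R.IsAdmissible) (hy : R.IsPeripheral j y) (hy0 : y ≠ 0) :
    IsSimpleModule (R.Inc)ᵐᵒᵖ (Submodule.span (R.Inc)ᵐᵒᵖ {y}) := by
  rw [isSimpleModule_iff_isAtom]
  refine ⟨by simpa using hy0, fun N hN => ?_⟩
  by_contra hne
  obtain ⟨z, hz, hz0⟩ := N.ne_bot_iff.1 hne
  obtain ⟨a, rfl⟩ := Submodule.mem_span_singleton.1 (hN.le hz)
  obtain ⟨b, hb⟩ := hy.exists_smul_smul_eq hR a
    (fun h => hz0 ((hy.smul_eq_zero_iff hR hy0 a).2 h))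
  apply hN.not_ge
  rw [Submodule.span_singleton_le_iff_mem, ← hb]
  exact N.smul_mem b hz

/-- Since `y` generates `X` and its annihilator is contained in that of `z`, the assignment `y a ↦ z
a` is well defined. -/
theorem exists_linearMap (hR : R.IsAdmissible) [IsSimpleModule (R.Inc)ᵐᵒᵖ X]
    (hy : R.IsPeripheral j y) (hy0 : y ≠ 0) (hz : R.IsPeripheral j z) :
    ∃ f : X →ₗ[(R.Inc)ᵐᵒᵖ] Z, f y = z := by
  let p := LinearMap.toSpanSingleton (R.Inc)ᵐᵒᵖ X y
  let q := LinearMap.toSpanSingleton (R.Inc)ᵐᵒᵖ Z z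
  have hp : Function.Surjective p := IsSimpleModule.toSpanSingleton_surjective _ hy0
  have hpq : LinearMap.ker p ≤ LinearMap.ker q := by
    intro a ha
    have h := (hy.smul_eq_zero_iff hR hy0 a).1 ha
    change a • z = 0
    rw [hz.smul_eq a, Inc.single_congr _ h, Inc.single_zero, op_zero, zero_smul]
  refine ⟨((LinearMap.ker p).liftQ q hpq).comp (p.quotKerEquivOfSurjective hp).symm.toLinearMap, ?_⟩
  have h1 : (p.quotKerEquivOfSurjective hp).symm y = (LinearMap.ker p).mkQ 1 := by
    rw [LinearEquiv.symm_apply_eq]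
    change y = p 1
    exact (one_smul _ y).symm
  change (LinearMap.ker p).liftQ q hpq ((p.quotKerEquivOfSurjective hp).symm y) = z
  rw [h1]
  exact one_smul _ z

theorem nonempty_linearEquiv (hR : R.IsAdmissible) [IsSimpleModule (R.Inc)ᵐᵒᵖ X]
    [IsSimpleModule (R.Inc)ᵐᵒᵖ Z] (hy : R.IsPeripheral j y) (hy0 : y ≠ 0)
    (hz : R.IsPeripheral j z) (hz0 : z ≠ 0) : Nonempty (X ≃ₗ[(R.Inc)ᵐᵒᵖ] Z) := by
  obtain ⟨f, hf⟩ := hy.exists_linearMap hR hy0 hz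
  refine ⟨LinearEquiv.ofBijective f (LinearMap.bijective_of_ne_zero ?_)⟩
  rintro rfl
  exact hz0 hf.symm

end IsPeripheral

end Peripheral

/-! ### Socle-projective modules over the incidence algebra of an admissible system -/

section TopSeparated

variable [OrderTop P]

/-- No nonzero element of the module is annihilated by all `R i ⊤`. -/
def TopSeparated (R : MultSystem K P A) (X : Type u) [AddCommGroup X] [Module (R.Inc)ᵐᵒᵖ X] :
    Prop :=
  ∀ x : X, (∀ i r hr, op (Inc.single (R := R) i ⊤ r hr) • x = 0) → x = 0

variable {X : Type u} [AddCommGroup X] [Module (R.Inc)ᵐᵒᵖ X]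

/-- Both `x` and the idempotent `e_⊤` of the algebra are peripheral at `⊤`, so `x ↦ e_⊤` defines a
map from `X` to the algebra that is split by `a ↦ x a`. -/
theorem projective_of_single_top_smul_eq (hR : R.IsAdmissible) [IsSimpleModule (R.Inc)ᵐᵒᵖ X]
    {x : X} (hx : op (Inc.single ⊤ ⊤ (R.one ⊤) (R.one_mem ⊤)) • x = x) (hx0 : x ≠ 0) :
    Module.Projective (R.Inc)ᵐᵒᵖ X := by
  have hz : R.IsPeripheral ⊤ (op (Inc.single (R := R) ⊤ ⊤ (R.one ⊤) (R.one_mem ⊤))) :=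
    isPeripheral_top (by
      rw [smul_eq_mul, ← op_mul, Inc.single_mul_single,
        Inc.single_congr _ (R.one_mul_mem (R.one_mem ⊤))])
  obtain ⟨f, hf⟩ := (isPeripheral_top hx).exists_linearMap hR hx0 hz
  refine Module.Projective.of_split f (LinearMap.toSpanSingleton (R.Inc)ᵐᵒᵖ X x) ?_
  ext y
  obtain ⟨a, rfl⟩ := IsSimpleModule.toSpanSingleton_surjective (R.Inc)ᵐᵒᵖ hx0 y
  simp only [LinearMap.comp_apply, LinearMap.toSpanSingleton_apply, map_smul, hf, hx,
    LinearMap.id_apply]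

theorem isSemisimpleModule_socle (S M : Type u) [Ring S] [AddCommGroup M] [Module S M] :
    IsSemisimpleModule S (socle S M) := by
  rw [socle, sSup_eq_iSup]
  exact isSemisimpleModule_biSup_of_isSemisimpleModule_submodule fun N hN => by
    have : IsSimpleModule S N := hN
    infer_instance

theorem TopSeparated.projective_of_isSemisimpleModule (hR : R.IsAdmissible)
    (hX : R.TopSeparated X) [IsSemisimpleModule (R.Inc)ᵐᵒᵖ X] :
    Module.Projective (R.Inc)ᵐᵒᵖ X := by
  classical
  obtain ⟨s, e, -, hs⟩ := IsSemisimpleModule.exists_linearEquiv_dfinsupp (R.Inc)ᵐᵒᵖ X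
  have : ∀ m : s, Module.Projective (R.Inc)ᵐᵒᵖ m.1 := by
    intro m
    have := hs m
    have := IsSimpleModule.nontrivial (R.Inc)ᵐᵒᵖ m.1
    obtain ⟨x, hx⟩ := exists_ne (0 : m.1)
    -- Separation provides a nonzero `x r` in the simple summand, and this element is fixed by
    -- `e_⊤`.
    have : ∃ i r hr, op (Inc.single (R := R) i ⊤ r hr) • x ≠ 0 := by
      by_contra! h
      exact hx (Subtype.ext (hX x.1 fun i r hr => congrArg Subtype.val (h i r hr)))
    obtain ⟨i, r, hr, h⟩ := this
    refine projective_of_single_top_smul_eq hR ?_ h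
    refine (smul_single_smul_single (X := m.1) hr (R.one_mem ⊤) x).trans ?_
    rw [Inc.single_congr _ (R.mul_one_mem hr)]
  exact Module.Projective.of_equiv e.symm

theorem TopSeparated.projective_socle (hR : R.IsAdmissible) (hX : R.TopSeparated X) :
    Module.Projective (R.Inc)ᵐᵒᵖ (socle (R.Inc)ᵐᵒᵖ X) := by
  have := isSemisimpleModule_socle (R.Inc)ᵐᵒᵖ X
  refine TopSeparated.projective_of_isSemisimpleModule hR fun x hx => Subtype.ext ?_
  exact hX x.1 fun i r hr => congrArg Subtype.val (hx i r hr)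

/-- The elements annihilated by all `R i ⊤`. -/
def topAnnihilated (R : MultSystem K P A) (X : Type u) [AddCommGroup X] [Module (R.Inc)ᵐᵒᵖ X] :
    Submodule (R.Inc)ᵐᵒᵖ X where
  carrier := {x | ∀ i r hr, op (Inc.single (R := R) i ⊤ r hr) • x = 0}
  zero_mem' _ _ _ := smul_zero _
  add_mem' hx hy i r hr := by rw [smul_add, hx i r hr, hy i r hr, add_zero]
  smul_mem' a x hx i r hr := by
    -- Left multiplication keeps an entry in column `⊤` within that column.
    rw [← op_unop a, ← mul_smul, ← op_mul, Inc.mul_single, Finset.op_sum, Finset.sum_smul]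
    exact Finset.sum_eq_zero fun k _ => hx k _ _

/-- A splitting sends `y` to some `c` with `y c = y`, so `c j j` is invertible. But `c`, like `y`,
is annihilated by every `R j l` with `l ≠ j`, and admissibility applied to `1_j` provides an `r`
there with `1_j r ≠ 0`. -/
theorem not_projective_span_of_isPeripheral (hR : R.IsAdmissible) {j : P} (hj : j < ⊤) {y : X}
    (hy : R.IsPeripheral j y) (hy0 : y ≠ 0) :
    ¬ Module.Projective (R.Inc)ᵐᵒᵖ (Submodule.span (R.Inc)ᵐᵒᵖ {y}) := by
  intro hproj
  have := hy.isSimpleModule_span hR hy0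
  let y' : Submodule.span (R.Inc)ᵐᵒᵖ {y} := ⟨y, Submodule.mem_span_singleton_self y⟩
  have hy' : R.IsPeripheral j y' :=
    ⟨Subtype.ext hy.1, fun l hl r hr => Subtype.ext (hy.2 l hl r hr)⟩
  have hy0' : y' ≠ 0 := fun h => hy0 (congrArg Subtype.val h)
  obtain ⟨f, hf⟩ := Module.projective_lifting_property
    (LinearMap.toSpanSingleton (R.Inc)ᵐᵒᵖ _ y') LinearMap.id
    (IsSimpleModule.toSpanSingleton_surjective _ hy0')
  have hc : f y' • y' = y' := LinearMap.congr_fun hf y'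
  have hc0 : (f y').unop.entry j j ≠ 0 := fun h =>
    hy0' (by rw [← hc, (hy'.smul_eq_zero_iff hR hy0' _).2 h])
  obtain ⟨l, hjl, hlj, r, hr, hne⟩ :=
    hR.exists_mul_ne_zero j j le_rfl hj _ (R.one_mem j) (hR.one_ne_zero j)
  obtain ⟨s, hs, -, h⟩ := hR.exists_inv j _ ((f y').unop.entry_mem j j) hc0
  apply hne
  have h0 : (f y').unop * Inc.single j l r hr = 0 := by
    have := congrArg (fun z => (f z).unop) (hy'.2 l hlj r hr)
    simpa using this
  have h1 : (f y').unop.entry j j * r = 0 := by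
    have := congrFun (congrFun (congrArg Inc.entry h0) j) l
    simpa using this
  rw [← h, mul_assoc, h1, mul_zero]

theorem topSeparated_of_projective_socle (hR : R.IsAdmissible)
    (hX : Module.Projective (R.Inc)ᵐᵒᵖ (socle (R.Inc)ᵐᵒᵖ X)) : R.TopSeparated X := by
  have hsemi := isSemisimpleModule_socle (R.Inc)ᵐᵒᵖ X
  by_contra hne
  have hnt : Nontrivial (R.topAnnihilated X) := by
    rw [Submodule.nontrivial_iff_ne_bot]
    intro h
    refine hne fun x hx => ?_
    have : x ∈ R.topAnnihilated X := hx
    rwa [h, Submodule.mem_bot] at this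
  obtain ⟨j, y, hy0, hy⟩ := R.exists_isPeripheral (X := R.topAnnihilated X)
  -- At `j = ⊤` the equation `y e_⊤ = y` would give `y = 0`, as `e_⊤` has its only entry in column
  -- `⊤`.
  have hj : j < ⊤ := by
    rw [lt_top_iff_ne_top]
    rintro rfl
    exact hy0 (by rw [← hy.1]; exact Subtype.ext (y.2 _ _ _))
  have hy0' : y.1 ≠ 0 := fun h => hy0 (Subtype.ext h)
  have hy' : R.IsPeripheral j y.1 :=
    ⟨congrArg Subtype.val hy.1, fun l hl r hr => congrArg Subtype.val (hy.2 l hl r hr)⟩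
  have hle : Submodule.span (R.Inc)ᵐᵒᵖ {y.1} ≤ socle (R.Inc)ᵐᵒᵖ X :=
    le_sSup (hy'.isSimpleModule_span hR hy0')
  let z : socle (R.Inc)ᵐᵒᵖ X := ⟨y.1, hle (Submodule.mem_span_singleton_self _)⟩
  have hz : R.IsPeripheral j z :=
    ⟨Subtype.ext hy'.1, fun l hl r hr => Subtype.ext (hy'.2 l hl r hr)⟩
  have hz0 : z ≠ 0 := fun h => hy0' (congrArg Subtype.val h)
  refine not_projective_span_of_isPeripheral hR hj hz hz0 ?_
  -- The socle is semisimple, so this simple submodule is a direct summand and inherits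
  -- projectivity.
  obtain ⟨N, hN⟩ := exists_isCompl (Submodule.span (R.Inc)ᵐᵒᵖ {z})
  refine Module.Projective.of_split (Submodule.subtype _) (Submodule.projectionOnto _ _ hN) ?_
  exact LinearMap.ext fun x => Submodule.projectionOnto_apply_left hN x

end TopSeparated

end MultSystem

namespace MultSystem

variable {K P A : Type u} [Field K] [PartialOrder P] [Fintype P] [DecidableEq P] [Ring A]
  [Algebra K A]

/-! ### Full idempotents from a Morita equivalence -/

/-- An incidence algebra with admissible system has at most `card P` simple modules. -/
theorem exists_ne_nonempty_linearEquiv [OrderTop P] {R : MultSystem K P A} (hR : R.IsAdmissible)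
    (X : Option P → ModuleCat.{u} (R.Inc)ᵐᵒᵖ) (hX : ∀ a, IsSimpleModule (R.Inc)ᵐᵒᵖ (X a)) :
    ∃ a b, a ≠ b ∧ Nonempty (X a ≃ₗ[(R.Inc)ᵐᵒᵖ] X b) := by
  have hne : ∀ a, ∃ (j : P) (y : X a), y ≠ 0 ∧ R.IsPeripheral j y := fun a => by
    have := IsSimpleModule.nontrivial (R.Inc)ᵐᵒᵖ (X a)
    exact R.exists_isPeripheral
  choose j y hy0 hy using hne
  -- Pigeonhole: `Option P` has one element more than `P`.
  obtain ⟨a, b, hab, h⟩ := Fintype.exists_ne_map_eq_of_card_lt j (by simp)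
  exact ⟨a, b, hab, (hy a).nonempty_linearEquiv hR (hy0 a) (h ▸ hy b) (hy0 b)⟩

section Full

variable (T : MultSystem K P A) (ε : P → A)
  (hmem : ∀ i, ε i ∈ T.space i i)

/-- The module is a simple quotient by a maximal right ideal containing `J`. As `1 - e_j ε_j` lies
in `J`, the idempotent `e_j ε_j` cannot annihilate the class of `1`; for `i ≠ j`, every product `a
e_i ε_i` has zero entry at `(j, j)` and so lies in `J`. -/
theorem exists_isSimpleModule_of_ne_zero {j : P} (hj : ε j ≠ 0) (hε : ∀ i, IsIdempotentElem (ε i)) :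
    ∃ S : ModuleCat.{u} (T.Inc)ᵐᵒᵖ, IsSimpleModule (T.Inc)ᵐᵒᵖ S ∧
      (∃ x : S, op (Inc.single j j (ε j) (hmem j)) • x ≠ 0) ∧
      ∀ i, i ≠ j → ∀ x : S, op (Inc.single i i (ε i) (hmem i)) • x = 0 := by
  let J : Submodule (T.Inc)ᵐᵒᵖ (T.Inc)ᵐᵒᵖ :=
    { carrier := {a | ε j * a.unop.entry j j = 0}
      zero_mem' := by simp
      add_mem' := fun {a b} ha hb => by
        have ha : ε j * a.unop.entry j j = 0 := ha
        have hb : ε j * b.unop.entry j j = 0 := hb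
        simp [mul_add, ha, hb]
      smul_mem' := fun c a ha => by
        have ha : ε j * a.unop.entry j j = 0 := ha
        change ε j * (a.unop * c.unop).entry j j = 0
        rw [Inc.entry_mul_self, ← mul_assoc, ha, zero_mul] }
  have hJ : J ≠ ⊤ := by
    intro h
    have h1 : (1 : (T.Inc)ᵐᵒᵖ) ∈ J := h ▸ Submodule.mem_top
    have h1 : ε j * (1 : T.Inc).entry j j = 0 := h1
    rw [Inc.entry_one, Matrix.diagonal_apply_eq, T.mul_one_mem (hmem j)] at h1
    exact hj h1
  obtain ⟨m, hm, hJm⟩ := Ideal.exists_le_maximal J hJ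
  refine ⟨ModuleCat.of _ ((T.Inc)ᵐᵒᵖ ⧸ (m : Submodule (T.Inc)ᵐᵒᵖ (T.Inc)ᵐᵒᵖ)),
    isSimpleModule_iff_isCoatom.2 hm.out, ⟨Submodule.Quotient.mk 1, ?_⟩, ?_⟩
  · intro h
    have h1 : op (Inc.single j j (ε j) (hmem j)) ∈ m := by
      rw [← mul_one (op (Inc.single j j (ε j) (hmem j)))]
      exact (Submodule.Quotient.mk_eq_zero _).1 h
    have h2 : (1 : (T.Inc)ᵐᵒᵖ) - op (Inc.single j j (ε j) (hmem j)) ∈ m := by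
      refine hJm ?_
      change ε j * ((1 : T.Inc) - Inc.single j j (ε j) (hmem j)).entry j j = 0
      rw [sub_eq_add_neg, ← neg_one_smul K (Inc.single j j (ε j) (hmem j)), Inc.entry_add,
        Inc.entry_smul, Inc.entry_one, Matrix.add_apply, Matrix.diagonal_apply_eq, mul_add,
        T.mul_one_mem (hmem j)]
      simp [(hε j).eq]
    refine hm.ne_top ((Ideal.eq_top_iff_one _).2 ?_)
    simpa using add_mem h2 h1
  · intro i hi x
    obtain ⟨a, rfl⟩ := Submodule.Quotient.mk_surjective _ x
    refine (Submodule.Quotient.mk_eq_zero _).2 (hJm ?_)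
    change ε j * (a.unop * Inc.single i i (ε i) (hmem i)).entry j j = 0
    rw [Inc.entry_mul_self, Inc.entry_single, Matrix.single_apply_of_ne _ _ _ _ _ (by simp [hi]),
      mul_zero, mul_zero]

/-- The span is the two-sided ideal generated by the `e_i ε_i`, written as a left ideal of the
opposite ring. Were it proper, there would be `card P + 1` pairwise non-isomorphic simple modules,
while the equivalent category allows at most `card P`. -/
theorem span_eq_top_of_equivalence [OrderTop P] {R : MultSystem K P A} (hR : R.IsAdmissible)
    (hε : ∀ i, IsIdempotentElem (ε i)) (hε0 : ∀ i, ε i ≠ 0)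
    (F : ModuleCat.{u} (T.Inc)ᵐᵒᵖ ⥤ ModuleCat.{u} (R.Inc)ᵐᵒᵖ) [F.IsEquivalence] :
    Submodule.span (T.Inc)ᵐᵒᵖ
      (Set.range fun p : T.Inc × P => op (p.1 * Inc.single p.2 p.2 (ε p.2) (hmem p.2))) = ⊤ := by
  by_contra hI
  obtain ⟨m, hm, hIm⟩ := Ideal.exists_le_maximal _ hI
  choose S hS hS1 hS2 using fun j => T.exists_isSimpleModule_of_ne_zero ε hmem (hε0 j) hε
  -- The value at `none` is the additional simple module, annihilated by every `e_i ε_i`; the values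
  -- at `some j` are told apart by `e_j ε_j`.
  let X : Option P → ModuleCat.{u} (T.Inc)ᵐᵒᵖ := fun o =>
    o.elim (ModuleCat.of _ ((T.Inc)ᵐᵒᵖ ⧸ (m : Submodule (T.Inc)ᵐᵒᵖ (T.Inc)ᵐᵒᵖ))) S
  have hX : ∀ o, IsSimpleModule (T.Inc)ᵐᵒᵖ (X o) := by
    rintro (_ | j)
    · exact isSimpleModule_iff_isCoatom.2 hm.out
    · exact hS j
  have hX0 : ∀ (o : Option P) (i : P), some i ≠ o → ∀ x : X o,
      op (Inc.single i i (ε i) (hmem i)) • x = 0 := by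
    rintro (_ | j) i hi x
    · obtain ⟨a, rfl⟩ := Submodule.Quotient.mk_surjective _ x
      exact (Submodule.Quotient.mk_eq_zero _).2
        (hIm (Submodule.subset_span ⟨(a.unop, i), rfl⟩))
    · exact hS2 j i (fun h => hi (congrArg some h)) x
  have hXe : ∀ a b : Option P, Nonempty (X a ≃ₗ[(T.Inc)ᵐᵒᵖ] X b) → ∀ j, a = some j → b = some j := by
    rintro a b ⟨e⟩ j rfl
    by_contra hb
    obtain ⟨x, hx⟩ := hS1 j
    exact hx (e.injective
      (((map_smul e _ x).trans (hX0 b j (Ne.symm hb) (e x))).trans (map_zero e).symm))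
  have hFX : ∀ o, IsSimpleModule (R.Inc)ᵐᵒᵖ (F.obj (X o)) := fun o => by
    have : Simple (X o) := (simple_iff_isSimpleModule' _).2 (hX o)
    exact (simple_iff_isSimpleModule' _).1 (CategoryTheory.simple_obj F (X o))
  obtain ⟨a, b, hab, ⟨e⟩⟩ := exists_ne_nonempty_linearEquiv hR (fun o => F.obj (X o)) hFX
  have e' : X a ≃ₗ[(T.Inc)ᵐᵒᵖ] X b := (F.preimageIso e.toModuleIso).toLinearEquiv
  rcases a with _ | j
  · rcases b with _ | j
    · exact hab rfl
    · exact hab (hXe _ _ ⟨e'.symm⟩ j rfl)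
  · exact hab (hXe _ _ ⟨e'⟩ j rfl).symm

theorem exists_sum_mul_mul_eq_one [OrderTop P] {R : MultSystem K P A} (hR : R.IsAdmissible)
    (hε : ∀ i, IsIdempotentElem (ε i)) (hε0 : ∀ i, ε i ≠ 0)
    (hmem : ∀ i, ε i ∈ T.space i i)
    (h : IsMoritaEquivalent K (T.Inc)ᵐᵒᵖ (R.Inc)ᵐᵒᵖ) (j : P) :
    ∃ (n : ℕ) (a b : Fin n → A), (∀ k, a k ∈ T.space j j) ∧ (∀ k, b k ∈ T.space j j) ∧
      ∑ k, a k * ε j * b k = T.one j := by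
  obtain ⟨⟨e⟩⟩ := h
  have h1 : (1 : (T.Inc)ᵐᵒᵖ) ∈ Submodule.span (T.Inc)ᵐᵒᵖ
      (Set.range fun p : T.Inc × P => op (p.1 * Inc.single p.2 p.2 (ε p.2) (hmem p.2))) := by
    rw [T.span_eq_top_of_equivalence ε hmem hR hε hε0 e.eqv.functor]
    exact Submodule.mem_top
  obtain ⟨n, f, g, hfg⟩ := Submodule.mem_span_set'.1 h1
  choose p hp using fun k => (g k).2
  -- Generators belonging to a point other than `j` contribute nothing to the `(j, j)` entry, so
  -- their coefficient is set to `0`.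
  refine ⟨n, fun k => if (p k).2 = j then (p k).1.entry j j else 0,
    fun k => (f k).unop.entry j j, fun k => ?_, fun k => Inc.entry_mem _ _ _, ?_⟩
  · dsimp only
    split_ifs
    · exact Inc.entry_mem _ _ _
    · exact zero_mem _
  · have h2 := congrArg (fun z => z.unop.entry j j) hfg
    simp only [Finset.unop_sum, Inc.entry_sum, Matrix.sum_apply, unop_one, Inc.entry_one,
      Matrix.diagonal_apply_eq] at h2
    rw [← h2]
    refine Finset.sum_congr rfl fun k _ => ?_
    rw [← hp k]
    change _ = ((p k).1 * Inc.single (p k).2 (p k).2 (ε (p k).2) (hmem _) * (f k).unop).entry j j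
    rw [Inc.entry_mul_self, Inc.entry_mul_self, Inc.entry_single]
    beta_reduce
    split_ifs with hk
    · subst hk
      rw [Matrix.single_apply_same]
    · rw [Matrix.single_apply_of_ne _ _ _ _ _ (by simp [hk]), mul_zero, zero_mul]

end Full

end MultSystem

section Cut

variable {K P A : Type u} [Field K] [PartialOrder P] [Fintype P] [DecidableEq P] [Ring A]
  [Algebra K A] {T : MultSystem K P A} {ε : P → A} (hε : ∀ i, IsIdempotentElem (ε i))
  (hmem : ∀ i, ε i ∈ T.space i i)

/-! ### The modules `𝔲(L) ε` -/

theorem MultSystem.mul_mul_mem_corner {i j : P} {c : A} (hc : c ∈ T.space i j) :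
    ε i * c * ε j ∈ (T.corner ε hε hmem).space i j :=
  MultSystem.mem_corner.2 ⟨c, hc, rfl⟩

theorem MultSystem.idem_mem_corner (i : P) : ε i ∈ (T.corner ε hε hmem).space i i :=
  (T.corner ε hε hmem).one_mem i

theorem MultSystem.idem_mul_of_mem_corner {i j : P} {r : A}
    (hr : r ∈ (T.corner ε hε hmem).space i j) : ε i * r = r :=
  (T.corner ε hε hmem).one_mul_mem hr

theorem MultSystem.mul_idem_of_mem_corner {i j : P} {r : A}
    (hr : r ∈ (T.corner ε hε hmem).space i j) : r * ε j = r :=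
  (T.corner ε hε hmem).mul_one_mem hr

namespace Rep

/-- The element of `𝔲(L)` with the single component `x ∈ L i`, at the place `i`. -/
def U.single {L : Rep T} (i : P) : L.sub i →+ L.U :=
  AddMonoidHom.single (fun i => L.sub i) i

theorem U.comp_single_same {L : Rep T} (i : P) (x : L.sub i) :
    (U.single i x).comp i = x :=
  congrArg Subtype.val (Pi.single_eq_same (M := fun i => L.sub i) i x)

theorem U.comp_single_of_ne {L : Rep T} {i j : P} (h : j ≠ i) (x : L.sub i) :
    (U.single i x).comp j = 0 :=
  congrArg Subtype.val (Pi.single_eq_of_ne (M := fun i => L.sub i) h x)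

/-- The action of `r ∈ T i j` as a map `L i → L j`. -/
def act (L : Rep T) {i j : P} {r : A} (hr : r ∈ T.space i j) : L.sub i →+ L.sub j where
  toFun x := ⟨op r • x.1, L.smul_mem' x.2 hr⟩
  map_zero' := Subtype.ext (smul_zero _)
  map_add' _ _ := Subtype.ext (smul_add _ _ _)

@[simp] theorem coe_act (L : Rep T) {i j : P} {r : A} (hr : r ∈ T.space i j) (x : L.sub i) :
    (L.act hr x : L.carrier) = op r • x.1 := rfl

theorem cut_smul_comp {L : Rep T} (a : (T.corner ε hε hmem).Inc)
    (y : cutSubgroup (T.cornerIncl ε hε hmem) L.U) (i : P) :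
    (op a • y).1.comp i = ∑ j, op (a.entry j i) • y.1.comp j := rfl

theorem op_cornerIncl_one_smul_comp {L : Rep T} (y : L.U) (i : P) :
    (op (T.cornerIncl ε hε hmem 1) • y).comp i = op (ε i) • y.comp i := by
  rw [U.comp_smul, Finset.sum_eq_single i]
  · rw [unop_op, MultSystem.entry_cornerIncl_one, Matrix.diagonal_apply_eq]
  · intro j _ hj
    rw [unop_op, MultSystem.entry_cornerIncl_one, Matrix.diagonal_apply_ne _ hj, op_zero, zero_smul]
  · intro h
    exact absurd (Finset.mem_univ i) h

variable {hε hmem}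

theorem cut_idem_smul_comp {L : Rep T} (y : cutSubgroup (T.cornerIncl ε hε hmem) L.U) (i : P) :
    op (ε i) • y.1.comp i = y.1.comp i := by
  obtain ⟨_, y, rfl⟩ := y
  change op (ε i) • (op (T.cornerIncl ε hε hmem 1) • y).comp i
    = (op (T.cornerIncl ε hε hmem 1) • y).comp i
  rw [op_cornerIncl_one_smul_comp, ← mul_smul, ← op_mul, (hε i).eq]

theorem mem_cutSubgroup {L : Rep T} {y : L.U} (hy : ∀ i, op (ε i) • y.comp i = y.comp i) :
    y ∈ cutSubgroup (T.cornerIncl ε hε hmem) L.U :=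
  ⟨y, U.ext fun i => (op_cornerIncl_one_smul_comp hε hmem y i).trans (hy i)⟩

variable (hε hmem)

theorem single_idem_smul_mem_cutSubgroup {L : Rep T} (i : P) (x : L.sub i) :
    U.single i (L.act (hmem i) x) ∈ cutSubgroup (T.cornerIncl ε hε hmem) L.U := by
  refine mem_cutSubgroup fun j => ?_
  by_cases h : j = i
  · subst h
    rw [U.comp_single_same, coe_act, ← mul_smul, ← op_mul, (hε j).eq]
  · rw [U.comp_single_of_ne h, smul_zero]

/-- For `x ∈ L i`, the element of `𝔲(L) ε` with the single component `x ε_i`, at the place `i`. -/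
def cutSingle (L : Rep T) (i : P) : L.sub i →+ cutSubgroup (T.cornerIncl ε hε hmem) L.U where
  toFun x := ⟨U.single i (L.act (hmem i) x), single_idem_smul_mem_cutSubgroup hε hmem i x⟩
  map_zero' := Subtype.ext (by simp)
  map_add' x y := Subtype.ext (by simp)

theorem comp_cutSingle_same {L : Rep T} (i : P) (x : L.sub i) :
    (L.cutSingle hε hmem i x).1.comp i = op (ε i) • x.1 :=
  U.comp_single_same i _

variable {hε hmem}

theorem single_smul_eq_cutSingle {L : Rep T} {i j : P} {r : A}
    (hr : r ∈ (T.corner ε hε hmem).space i j) (y : cutSubgroup (T.cornerIncl ε hε hmem) L.U)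
    (hx : op r • y.1.comp i ∈ L.sub j) :
    op (MultSystem.Inc.single i j r hr) • y = L.cutSingle hε hmem j ⟨op r • y.1.comp i, hx⟩ := by
  refine Subtype.ext (U.ext fun k => ?_)
  rw [cut_smul_comp, Finset.sum_eq_single i]
  · by_cases h : k = j
    · subst h
      rw [comp_cutSingle_same, MultSystem.Inc.entry_single, Matrix.single_apply_same,
        ← mul_smul, ← op_mul, MultSystem.mul_idem_of_mem_corner hε hmem hr]
    · rw [MultSystem.Inc.entry_single, Matrix.single_apply_of_ne _ _ _ _ _ (by simp [Ne.symm h]),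
        op_zero, zero_smul]
      exact (U.comp_single_of_ne h _).symm
  · intro l _ hl
    rw [MultSystem.Inc.entry_single, Matrix.single_apply_of_ne _ _ _ _ _ (by simp [Ne.symm hl]),
      op_zero, zero_smul]
  · intro h
    exact absurd (Finset.mem_univ i) h

theorem comp_single_smul {L : Rep T} {i j : P} {r : A}
    (hr : r ∈ (T.corner ε hε hmem).space i j) (y : cutSubgroup (T.cornerIncl ε hε hmem) L.U) :
    (op (MultSystem.Inc.single i j r hr) • y).1.comp j = op r • y.1.comp i := by
  rw [cut_smul_comp, Finset.sum_eq_single i]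
  · rw [MultSystem.Inc.entry_single, Matrix.single_apply_same]
  · intro l _ hl
    rw [MultSystem.Inc.entry_single, Matrix.single_apply_of_ne _ _ _ _ _ (by simp [Ne.symm hl]),
      op_zero, zero_smul]
  · intro h
    exact absurd (Finset.mem_univ i) h

end Rep

/-! ### Full idempotents, separation and faithfulness. -/

/-- The idempotents `ε i` are full in `T i i`, whose unit is that of `A`. -/
def IsFull (T : MultSystem K P A) (ε : P → A) : Prop :=
  ∀ i, ∃ (n : ℕ) (a b : Fin n → A), (∀ k, a k ∈ T.space i i) ∧ (∀ k, b k ∈ T.space i i) ∧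
    ∑ k, a k * ε i * b k = 1

theorem eq_sum_smul {M : Type u} [AddCommGroup M] [Module Aᵐᵒᵖ M] {n : ℕ} {a b : Fin n → A} {e : A}
    (h : ∑ k, a k * e * b k = 1) (x : M) : x = ∑ k, op (b k) • op e • op (a k) • x := by
  conv_lhs => rw [← one_smul Aᵐᵒᵖ x, ← op_one, ← h, Finset.op_sum, Finset.sum_smul]
  simp only [op_mul, mul_smul]

variable [OrderTop P]

theorem IsFull.eq_zero {M : Type u} [AddCommGroup M] [Module Aᵐᵒᵖ M] (h : IsFull T ε) {x : M}
    (hx : ∀ c, op (c * ε ⊤) • x = 0) : x = 0 := by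
  obtain ⟨n, a, b, -, -, hab⟩ := h ⊤
  rw [eq_sum_smul hab x]
  refine Finset.sum_eq_zero fun k _ => ?_
  rw [← mul_smul (op (ε ⊤)), ← op_mul, hx, smul_zero]

/-- Since `T i ⊤ = A`, being annihilated by `R i ⊤` means `y_i c ε_⊤ = 0` for all `c ∈ A`, and
fullness of `ε ⊤` gives `y_i = 0`. -/
theorem IsFull.topSeparated (h : IsFull T ε) (hT : ∀ i a, a ∈ T.space i ⊤) (L : Rep T) :
    (T.corner ε hε hmem).TopSeparated (cutSubgroup (T.cornerIncl ε hε hmem) L.U) := by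
  intro y hy
  refine Subtype.ext (Rep.U.ext fun i => ?_)
  refine h.eq_zero fun c => ?_
  have h1 := congrArg (fun z => z.1.comp ⊤)
    (hy i _ (MultSystem.mul_mul_mem_corner hε hmem (hT i c)))
  have h2 := (Rep.comp_single_smul _ y).symm.trans h1
  rwa [mul_assoc, op_mul, mul_smul, Rep.cut_idem_smul_comp] at h2

/-- The component at `⊤` records the morphism on `L ε_⊤`, which generates `L` over `A` by fullness
of `ε ⊤`. -/
theorem IsFull.cutMap_uMap_injective (h : IsFull T ε) {L M : Rep T} (hL : L.sub ⊤ = ⊤)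
    {g g' : L ⟶ M} (hg : cutMap (T.cornerIncl ε hε hmem) (Rep.uMap g)
      = cutMap (T.cornerIncl ε hε hmem) (Rep.uMap g')) : g = g' := by
  refine Rep.Hom.ext (LinearMap.ext fun x => ?_)
  rw [← sub_eq_zero]
  refine h.eq_zero fun c => ?_
  have hx : op c • x ∈ L.sub ⊤ := hL ▸ Submodule.mem_top
  have h1 := congrArg (fun z => z.1.comp ⊤) (LinearMap.congr_fun hg (L.cutSingle hε hmem ⊤ ⟨_, hx⟩))
  have h2 : Rep.Hom.toLin g ((L.cutSingle hε hmem ⊤ ⟨_, hx⟩).1.comp ⊤)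
    = Rep.Hom.toLin g' ((L.cutSingle hε hmem ⊤ ⟨_, hx⟩).1.comp ⊤) := h1
  rw [Rep.comp_cutSingle_same] at h2
  rw [smul_sub, ← map_smul, ← map_smul, op_mul, mul_smul, h2, sub_self]

/-! ### Reconstructing a morphism of representations from a linear map of cut modules. -/

section FullFunctor

variable {L M : Rep T}
  (g : cutSubgroup (T.cornerIncl ε hε hmem) L.U →ₗ[((T.corner ε hε hmem).Inc)ᵐᵒᵖ]
    cutSubgroup (T.cornerIncl ε hε hmem) M.U)

/-- The map `L i → M i`, `x ↦ g (x ε_i)`. -/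
def cutComponent (i : P) : L.sub i →+ M.sub i where
  toFun x := ⟨(g (L.cutSingle hε hmem i x)).1.comp i, Rep.U.comp_mem _ i⟩
  map_zero' := Subtype.ext (by simp)
  map_add' x y := Subtype.ext (by simp)

theorem idem_smul_cutComponent (i : P) (x : L.sub i) :
    op (ε i) • (cutComponent hε hmem g i x).1 = (cutComponent hε hmem g i x).1 :=
  Rep.cut_idem_smul_comp _ i

theorem comp_map_smul {i j : P} {r : A} (hr : r ∈ (T.corner ε hε hmem).space i j)
    (y : cutSubgroup (T.cornerIncl ε hε hmem) L.U) (hx : op r • y.1.comp i ∈ L.sub j) :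
    (cutComponent hε hmem g j ⟨op r • y.1.comp i, hx⟩).1 = op r • (g y).1.comp i := by
  rw [← Rep.comp_single_smul hr (g y), ← map_smul, Rep.single_smul_eq_cutSingle hr y hx]
  rfl

theorem comp_map (y : cutSubgroup (T.cornerIncl ε hε hmem) L.U) (i : P) :
    (g y).1.comp i = (cutComponent hε hmem g i ⟨y.1.comp i, y.1.comp_mem i⟩).1 := by
  have h := comp_map_smul hε hmem g ((T.corner ε hε hmem).one_mem i) y
    (L.smul_mem' (y.1.comp_mem i) (hmem i))
  change _ = op (ε i) • _ at h
  rw [Rep.cut_idem_smul_comp] at h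
  rw [← h]
  congr 2
  exact Subtype.ext (Rep.cut_idem_smul_comp y i)

theorem cutComponent_smul {i j : P} {r : A} (hr : r ∈ (T.corner ε hε hmem).space i j)
    (x : L.sub i) (hx : op r • x.1 ∈ L.sub j) :
    (cutComponent hε hmem g j ⟨op r • x.1, hx⟩).1 = op r • (cutComponent hε hmem g i x).1 := by
  have h : op r • (L.cutSingle hε hmem i x).1.comp i = op r • x.1 := by
    rw [Rep.comp_cutSingle_same, ← mul_smul, ← op_mul, MultSystem.idem_mul_of_mem_corner hε hmem hr]
  have h' := comp_map_smul hε hmem g hr (L.cutSingle hε hmem i x) (h ▸ hx)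
  refine Eq.trans ?_ h'
  congr 3
  exact h.symm

theorem cutComponent_idem_smul {i : P} (x : L.sub i) (hx : op (ε i) • x.1 ∈ L.sub i) :
    (cutComponent hε hmem g i ⟨op (ε i) • x.1, hx⟩).1 = (cutComponent hε hmem g i x).1 :=
  (cutComponent_smul hε hmem g ((T.corner ε hε hmem).one_mem i) x hx).trans
    (idem_smul_cutComponent hε hmem g i x)

variable (hL : L.sub ⊤ = ⊤)

/-- The map `L → M`, `x ↦ g (x ε_⊤)`. -/
def cutTop : L.carrier →+ M.carrier where
  toFun x := (cutComponent hε hmem g ⊤ ⟨x, hL ▸ Submodule.mem_top⟩).1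
  map_zero' := congrArg Subtype.val (map_zero (cutComponent hε hmem g ⊤))
  map_add' x y := congrArg Subtype.val (map_add (cutComponent hε hmem g ⊤)
    ⟨x, hL ▸ Submodule.mem_top⟩ ⟨y, hL ▸ Submodule.mem_top⟩)

theorem cutTop_smul (hT : ∀ i a, a ∈ T.space i ⊤) {i : P} (c : A) (x : L.sub i) :
    cutTop hε hmem g hL (op (ε i * c) • x.1)
      = op (ε i * c * ε ⊤) • (cutComponent hε hmem g i x).1 := by
  have hx : op (ε i * c * ε ⊤) • x.1 ∈ L.sub ⊤ := hL ▸ Submodule.mem_top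
  have hx' : op (ε i * c) • x.1 ∈ L.sub ⊤ := hL ▸ Submodule.mem_top
  rw [← cutComponent_smul hε hmem g (MultSystem.mul_mul_mem_corner hε hmem (hT i c)) x hx]
  -- The component at `⊤` does not change when its argument is multiplied by `ε ⊤`.
  refine (cutComponent_idem_smul hε hmem g ⟨_, hx'⟩ (L.smul_mem' hx' (hmem ⊤))).symm.trans ?_
  congr 3
  rw [op_mul (ε i * c), mul_smul]

/-- The central identity for the reconstructed map `f x = ∑ g(x a_k ε_⊤) b_k`: it sends `x ε_i c` to
`g(x ε_i) ε_i c`. The case `i = ⊤` yields `A`-linearity, and `c = 1` yields agreement with `g` at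
every point. -/
theorem sum_smul_cutTop (hT : ∀ i a, a ∈ T.space i ⊤) {n : ℕ} {a b : Fin n → A}
    (hab : ∑ k, a k * ε ⊤ * b k = 1) {i : P} (c : A) (x : L.sub i) :
    ∑ k, op (b k) • cutTop hε hmem g hL (op (a k) • op (ε i * c) • x.1)
      = op (ε i * c) • (cutComponent hε hmem g i x).1 := by
  rw [eq_sum_smul hab (op (ε i * c) • (cutComponent hε hmem g i x).1)]
  refine Finset.sum_congr rfl fun k _ => ?_
  rw [← mul_smul (op (a k)) (op (ε i * c)), ← op_mul, mul_assoc, cutTop_smul hε hmem g hL hT]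
  simp only [op_mul, mul_smul]

theorem IsFull.exists_cutMap_uMap_eq (h : IsFull T ε) (hT : ∀ i a, a ∈ T.space i ⊤)
    (hL : L.sub ⊤ = ⊤) :
    ∃ f : L ⟶ M, cutMap (T.cornerIncl ε hε hmem) (Rep.uMap f) = g := by
  obtain ⟨n, a, b, -, -, hab⟩ := h ⊤
  let f : L.carrier →ₗ[Aᵐᵒᵖ] M.carrier :=
    { toFun := fun x => ∑ k, op (b k) • cutTop hε hmem g hL (op (a k) • x)
      map_add' := fun x y => by simp only [smul_add, map_add, Finset.sum_add_distrib]
      map_smul' := fun c x => by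
        obtain ⟨c, rfl⟩ := op_surjective c
        -- Fullness writes `x c` as a sum of elements `x' ε_⊤ c'`, to which the identity at `i = ⊤`
        -- applies.
        have key : op c • x = ∑ l, op (ε ⊤ * (b l * c)) • op (a l) • x := by
          conv_lhs => rw [eq_sum_smul hab x, Finset.smul_sum]
          simp only [op_mul, mul_smul]
        rw [RingHom.id_apply, key]
        simp only [Finset.smul_sum, map_sum]
        rw [Finset.sum_comm]
        refine Finset.sum_congr rfl fun l _ => ?_
        have hl : op (a l) • x ∈ L.sub ⊤ := hL ▸ Submodule.mem_top
        refine (sum_smul_cutTop hε hmem g hL hT hab (b l * c) ⟨_, hl⟩).trans ?_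
        rw [op_mul, op_mul, mul_smul, mul_smul, idem_smul_cutComponent]
        rfl }
  have hf : ∀ (i : P) (x : L.sub i), f (op (ε i) • x.1) = (cutComponent hε hmem g i x).1 := by
    intro i x
    have := sum_smul_cutTop hε hmem g hL hT hab 1 x
    rw [mul_one, idem_smul_cutComponent] at this
    exact this
  refine ⟨⟨f, fun i x hx => ?_⟩, ?_⟩
  -- Here fullness of `ε i` inside `T i i` is needed: `x = ∑ x c_k ε_i d_k` with `c_k, d_k ∈ T i i`,
  -- so `f x` stays in `M i`.
  · obtain ⟨m, c, d, hc, hd, hcd⟩ := h i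
    rw [eq_sum_smul hcd x, map_sum]
    refine sum_mem fun k _ => ?_
    rw [map_smul, hf i ⟨_, L.smul_mem' hx (hc k)⟩]
    exact M.smul_mem' (cutComponent hε hmem g i _).2 (hd k)
  · ext y i
    rw [comp_map hε hmem g, ← hf, Rep.cut_idem_smul_comp]
    rfl

end FullFunctor

end Cut

section Coinduced

variable {K P A : Type u} [Field K] [PartialOrder P] [Fintype P] [DecidableEq P] [Ring A]
  [Algebra K A] {T : MultSystem K P A} {ε : P → A} (hε : ∀ i, IsIdempotentElem (ε i))
  (hmem : ∀ i, ε i ∈ T.space i i) [OrderTop P]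
  (X : Type u) [AddCommGroup X] [Module ((T.corner ε hε hmem).Inc)ᵐᵒᵖ X]

/-! ### The representation coinduced from a module over the corner algebra -/

/-- The additive maps `φ : A → X` with `φ (a ε_⊤) = φ a` and `φ (a d) = φ a d` for `d ∈ R ⊤ ⊤`. -/
def coindSubgroup : AddSubgroup (A →+ X) where
  carrier := {φ | (∀ a, φ (a * ε ⊤) = φ a) ∧
    ∀ a d hd, φ (a * d) = op (MultSystem.Inc.single (R := T.corner ε hε hmem) ⊤ ⊤ d hd) • φ a}
  zero_mem' := ⟨fun _ => rfl, fun _ _ _ => (smul_zero _).symm⟩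
  add_mem' h h' := ⟨fun a => by simp only [AddMonoidHom.add_apply, h.1, h'.1],
    fun a d hd => by simp only [AddMonoidHom.add_apply, h.2 a d hd, h'.2 a d hd, smul_add]⟩
  neg_mem' h := ⟨fun a => by simp only [AddMonoidHom.neg_apply, h.1],
    fun a d hd => by simp only [AddMonoidHom.neg_apply, h.2 a d hd, smul_neg]⟩

/-- The coinduced right `A`-module. -/
def Coind : Type u := coindSubgroup hε hmem X

instance : AddCommGroup (Coind hε hmem X) := inferInstanceAs (AddCommGroup (coindSubgroup hε hmem X))

variable {hε hmem X}

/-- The additive map underlying an element of the coinduced module. -/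
def Coind.toHom : Coind hε hmem X →+ (A →+ X) := (coindSubgroup hε hmem X).subtype

theorem Coind.ext {φ ψ : Coind hε hmem X} (h : ∀ a, φ.toHom a = ψ.toHom a) : φ = ψ :=
  Subtype.ext (AddMonoidHom.ext h)

theorem Coind.map_mul_idem (φ : Coind hε hmem X) (a : A) : φ.toHom (a * ε ⊤) = φ.toHom a :=
  φ.2.1 a

theorem Coind.map_mul (φ : Coind hε hmem X) (a : A) {d : A}
    (hd : d ∈ (T.corner ε hε hmem).space ⊤ ⊤) :
    φ.toHom (a * d) = op (MultSystem.Inc.single ⊤ ⊤ d hd) • φ.toHom a :=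
  φ.2.2 a d hd

instance : SMul Aᵐᵒᵖ (Coind hε hmem X) where
  smul c φ := ⟨φ.toHom.comp (AddMonoidHom.mulLeft c.unop), fun a => by
    change φ.toHom (c.unop * (a * ε ⊤)) = φ.toHom (c.unop * a)
    rw [← mul_assoc, φ.map_mul_idem], fun a d hd => by
    change φ.toHom (c.unop * (a * d)) = _ • φ.toHom (c.unop * a)
    rw [← mul_assoc, φ.map_mul _ hd]⟩

theorem Coind.toHom_smul (c : Aᵐᵒᵖ) (φ : Coind hε hmem X) (a : A) :
    (c • φ).toHom a = φ.toHom (c.unop * a) := rfl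

instance : Module Aᵐᵒᵖ (Coind hε hmem X) where
  one_smul φ := Coind.ext fun a => by rw [Coind.toHom_smul, unop_one, one_mul]
  mul_smul c d φ := Coind.ext fun a => by
    simp only [Coind.toHom_smul, unop_mul, mul_assoc]
  smul_zero c := Coind.ext fun a => by
    simp only [Coind.toHom_smul, map_zero, AddMonoidHom.zero_apply]
  smul_add c φ ψ := Coind.ext fun a => by
    simp only [Coind.toHom_smul, map_add, AddMonoidHom.add_apply]
  add_smul c d φ := Coind.ext fun a => by
    simp only [Coind.toHom_smul, map_add, MulOpposite.unop_add, add_mul, AddMonoidHom.add_apply]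
  zero_smul φ := Coind.ext fun a => by
    simp only [Coind.toHom_smul, unop_zero, zero_mul, map_zero, AddMonoidHom.zero_apply]

/-- Scalars act through `A`, on the argument of `φ`, so no `K`-structure on `X` has to be chosen. -/
instance : Module K (Coind hε hmem X) := Module.compHom _ (algebraMap K Aᵐᵒᵖ)

theorem Coind.toHom_field_smul (c : K) (φ : Coind hε hmem X) (a : A) :
    (c • φ).toHom a = φ.toHom (c • a) := by
  rw [Algebra.smul_def]
  rfl

instance : IsScalarTower K Aᵐᵒᵖ (Coind hε hmem X) where
  smul_assoc c a φ := Coind.ext fun b => by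
    rw [Coind.toHom_field_smul, Coind.toHom_smul, Coind.toHom_smul, unop_smul, smul_mul_assoc,
      mul_smul_comm]

/-- The maps `φ` whose restriction to each `t R j ⊤`, `t ∈ T i j`, is given by an element
of `X`. -/
def Coind.sub (i : P) : Submodule K (Coind hε hmem X) where
  carrier := {φ | ∀ j, ∀ t ∈ T.space i j, ∃ x : X, ∀ r hr, φ.toHom (t * r)
    = op (MultSystem.Inc.single (R := T.corner ε hε hmem) j ⊤ r hr) • x}
  zero_mem' _ _ _ := ⟨0, fun _ _ => (smul_zero _).symm⟩
  add_mem' {φ ψ} hφ hψ j t ht := by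
    obtain ⟨x, hx⟩ := hφ j t ht
    obtain ⟨y, hy⟩ := hψ j t ht
    refine ⟨x + y, fun r hr => ?_⟩
    rw [map_add, AddMonoidHom.add_apply, hx r hr, hy r hr, smul_add]
  smul_mem' c φ hφ j t ht := by
    obtain ⟨x, hx⟩ := hφ j (c • t) (Submodule.smul_mem _ c ht)
    refine ⟨x, fun r hr => ?_⟩
    rw [Coind.toHom_field_smul, ← smul_mul_assoc, hx r hr]

/-- At `j = ⊤` the required element of `X` is `φ t` itself, by linearity over `R ⊤ ⊤`; for other `j`
only `t = 0` occurs. -/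
theorem Coind.sub_top : Coind.sub (⊤ : P) = (⊤ : Submodule K (Coind hε hmem X)) := by
  rw [eq_top_iff]
  intro φ _ j t ht
  by_cases hj : j = ⊤
  · subst hj
    exact ⟨φ.toHom t, fun r hr => φ.map_mul t hr⟩
  · refine ⟨0, fun r hr => ?_⟩
    rw [T.eq_zero_of_not_le (fun h => hj (top_le_iff.1 h)) ht, zero_mul, map_zero, smul_zero]

variable (hε hmem X)

/-- The representation coinduced from `X`. -/
def coindRep (hone : ∀ i, T.one i = 1) : Rep T where
  carrier := Coind hε hmem X
  sub := Coind.sub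
  -- The condition on `φ s` at `t` is the one on `φ` at `s t`; this is why the subspaces are defined
  -- with all `t` and not just `t = 1`.
  smul_mem i j _ φ hφ s hs l t ht := by
    obtain ⟨x, hx⟩ := hφ l (s * t) (T.mul_mem hs ht)
    refine ⟨x, fun r hr => ?_⟩
    rw [Coind.toHom_smul, unop_op, ← mul_assoc, hx r hr]
  one_smul i φ _ := by rw [hone, op_one, one_smul]

variable (hT : ∀ i a, a ∈ T.space i ⊤)

/-- The map `b ↦ x ε_i b ε_⊤`. -/
def Coind.ofElem (i : P) (x : X) : Coind hε hmem X :=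
  ⟨{ toFun := fun b => op (MultSystem.Inc.single i ⊤ (ε i * b * ε ⊤)
        (MultSystem.mul_mul_mem_corner hε hmem (hT i b))) • x
     map_zero' := by
        rw [MultSystem.Inc.single_congr _ (show ε i * 0 * ε ⊤ = 0 by simp),
          MultSystem.Inc.single_zero, op_zero, zero_smul]
     map_add' := fun a b => by
        rw [← add_smul, ← MulOpposite.op_add, ← MultSystem.Inc.single_add]
        congr 2
        exact MultSystem.Inc.single_congr _ (by rw [mul_add, add_mul]) },
  fun a => by
    change op (MultSystem.Inc.single (R := T.corner ε hε hmem) i ⊤ _ _) • x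
      = op (MultSystem.Inc.single (R := T.corner ε hε hmem) i ⊤ _ _) • x
    congr 2
    exact MultSystem.Inc.single_congr _ (by simp only [mul_assoc, (hε ⊤).eq]),
  fun a d hd => by
    change op (MultSystem.Inc.single (R := T.corner ε hε hmem) i ⊤ _ _) • x
      = op (MultSystem.Inc.single ⊤ ⊤ d hd) •
        op (MultSystem.Inc.single (R := T.corner ε hε hmem) i ⊤ _ _) • x
    rw [MultSystem.smul_single_smul_single]
    congr 2
    refine MultSystem.Inc.single_congr _ ?_
    simp only [mul_assoc]
    rw [MultSystem.mul_idem_of_mem_corner hε hmem hd, MultSystem.idem_mul_of_mem_corner hε hmem hd]⟩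

variable {hε hmem X}

theorem Coind.toHom_ofElem (i : P) (x : X) (b : A) :
    (Coind.ofElem hε hmem X hT i x).toHom b = op (MultSystem.Inc.single i ⊤ (ε i * b * ε ⊤)
        (MultSystem.mul_mul_mem_corner hε hmem (hT i b))) • x := rfl

theorem Coind.ofElem_mem_sub (i : P) (x : X) :
    Coind.ofElem hε hmem X hT i x ∈ (Coind.sub i : Submodule K (Coind hε hmem X)) := by
  intro j t ht
  refine ⟨op (MultSystem.Inc.single i j (ε i * t * ε j)
    (MultSystem.mul_mul_mem_corner hε hmem ht)) • x, fun r hr => ?_⟩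
  rw [MultSystem.smul_single_smul_single, Coind.toHom_ofElem]
  congr 2
  refine MultSystem.Inc.single_congr _ ?_
  simp only [mul_assoc]
  rw [MultSystem.mul_idem_of_mem_corner hε hmem hr, MultSystem.idem_mul_of_mem_corner hε hmem hr]

theorem Coind.idem_smul_ofElem (i : P) (x : X) :
    op (ε i) • Coind.ofElem hε hmem X hT i x = Coind.ofElem hε hmem X hT i x := by
  refine Coind.ext fun b => ?_
  rw [Coind.toHom_smul, Coind.toHom_ofElem, Coind.toHom_ofElem]
  congr 2
  refine MultSystem.Inc.single_congr _ ?_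
  rw [unop_op, ← mul_assoc, (hε i).eq]

variable (hone : ∀ i, T.one i = 1)

variable (hε hmem X) in
/-- The canonical map from `X` to the module `𝔲(L) ε` of the coinduced representation `L`. -/
def coindUnit : X →ₗ[((T.corner ε hε hmem).Inc)ᵐᵒᵖ]
    cutSubgroup (T.cornerIncl ε hε hmem) (coindRep hε hmem X hone).U where
  toFun x := ⟨fun i => ⟨Coind.ofElem hε hmem X hT i x, Coind.ofElem_mem_sub hT i x⟩,
    Rep.mem_cutSubgroup fun i => Coind.idem_smul_ofElem hT i x⟩
  map_add' x y := Subtype.ext (Rep.U.ext fun i => Coind.ext fun b => smul_add _ x y)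
  map_smul' a x := Subtype.ext (Rep.U.ext fun i => Coind.ext fun b => by
    obtain ⟨a, rfl⟩ := op_surjective a
    change op (MultSystem.Inc.single (R := T.corner ε hε hmem) i ⊤ _ _) • op a • x = Coind.toHom
      (∑ j, op (a.entry j i) • Coind.ofElem hε hmem X hT j x) b
    rw [← mul_smul, ← op_mul, MultSystem.Inc.mul_single, Finset.op_sum, Finset.sum_smul, map_sum,
      AddMonoidHom.finsetSum_apply]
    refine Finset.sum_congr rfl fun j _ => ?_
    rw [Coind.toHom_smul, Coind.toHom_ofElem]
    congr 2
    refine MultSystem.Inc.single_congr _ ?_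
    rw [unop_op, ← mul_assoc, ← mul_assoc, ← mul_assoc,
      MultSystem.mul_idem_of_mem_corner hε hmem (a.entry_mem j i),
      MultSystem.idem_mul_of_mem_corner hε hmem (a.entry_mem j i)])

/-- The `i`-th component of the image of `x`, evaluated at `r ∈ R i ⊤`, is `x r`; so the kernel
consists of elements annihilated by all `R i ⊤`. -/
theorem coindUnit_injective (hX : (T.corner ε hε hmem).TopSeparated X) :
    Function.Injective (coindUnit hε hmem X hT hone) := by
  rw [injective_iff_map_eq_zero]
  intro x hx
  refine hX x fun i r hr => ?_
  have h : (Coind.ofElem hε hmem X hT i x).toHom r = 0 := by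
    have h0 : Coind.ofElem hε hmem X hT i x = 0 := congrArg (fun z => z.1.comp i) hx
    rw [h0, map_zero, AddMonoidHom.zero_apply]
  rw [← h, Coind.toHom_ofElem]
  congr 2
  refine MultSystem.Inc.single_congr _ ?_
  rw [MultSystem.idem_mul_of_mem_corner hε hmem hr, MultSystem.mul_idem_of_mem_corner hε hmem hr]

theorem coindUnit_surjective : Function.Surjective (coindUnit hε hmem X hT hone) := by
  intro y
  have hy : ∀ i, ∃ x : X, ∀ r hr, Coind.toHom (y.1.comp i : Coind hε hmem X) (1 * r)
      = op (MultSystem.Inc.single (R := T.corner ε hε hmem) i ⊤ r hr) • x := fun i =>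
    -- Membership of the `i`-th component in its subspace, used at `j = i` and `t = 1`, provides an
    -- `x i` representing it on `R i ⊤`; the preimage is assembled from the elements `x i e_i`.
    y.1.comp_mem i i 1 (hone i ▸ T.one_mem i)
  choose x hx using hy
  refine ⟨∑ i, op (MultSystem.Inc.single i i (ε i)
    (MultSystem.idem_mem_corner hε hmem i)) • x i,
    Subtype.ext (Rep.U.ext fun i => Coind.ext fun b => ?_)⟩
  change op (MultSystem.Inc.single (R := T.corner ε hε hmem) i ⊤ (ε i * b * ε ⊤) _) • (_ : X) = _
  rw [Finset.smul_sum, Finset.sum_eq_single i]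
  · rw [MultSystem.smul_single_smul_single, ← hx i, one_mul, ← mul_assoc,
      ← mul_assoc, (hε i).eq]
    refine (Coind.map_mul_idem (y.1.comp i : Coind hε hmem X) _).trans ?_
    exact congrArg (fun φ : Coind hε hmem X => φ.toHom b) (Rep.cut_idem_smul_comp y i)
  · intro j _ hj
    exact MultSystem.smul_single_smul_single_of_ne hj _ _ _
  · intro h
    exact absurd (Finset.mem_univ i) h

end Coinduced

/-! ### Representations with `L_⊤ = L` -/

section TopFunctor

variable {K P A : Type u} [Field K] [PartialOrder P] [Ring A] [Algebra K A]
  (T : MultSystem K P A) (hT : ∀ i, (1 : A) ∈ T.space i i)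

/-- The restriction of a representation of `(P^m, A, T^m)` to `P`. -/
def restrictTop (L : Rep (T.extend hT)) : Rep T where
  carrier := L.carrier
  sub i := L.sub i
  smul_mem _ _ _ _ hx r hr := L.smul_mem' hx (r := r) hr
  one_smul i x _ := by rw [T.one_eq_one hT i, op_one, one_smul]

theorem nonempty_topFunctor_obj_restrictTop_iso (L : Rep (T.extend hT)) (hL : L.sub ⊤ = ⊤) :
    Nonempty ((topFunctor T hT).obj (restrictTop T hT L) ≅ L) :=
  ⟨{ hom := ⟨(LinearMap.id : L.carrier →ₗ[Aᵐᵒᵖ] L.carrier), fun i x hx => by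
       rcases i with _ | i
       · exact hL ▸ Submodule.mem_top
       · exact hx⟩
     inv := ⟨(LinearMap.id : L.carrier →ₗ[Aᵐᵒᵖ] L.carrier), fun i x hx => by
       rcases i with _ | i
       · exact (Submodule.mem_top : x ∈ (⊤ : Submodule K L.carrier))
       · exact hx⟩
     hom_inv_id := rfl
     inv_hom_id := rfl }⟩

instance : (topFunctor T hT).Faithful where
  map_injective h := Rep.Hom.ext (congrArg (Rep.Hom.toLin (R := T.extend hT)) h)

instance : (topFunctor T hT).Full where
  map_surjective f := ⟨⟨Rep.Hom.toLin (R := T.extend hT) f, fun i =>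
    Rep.Hom.map_mem (R := T.extend hT) f (WithTop.some i)⟩, rfl⟩

theorem extend_space_top (i : WithTop P) (a : A) : a ∈ (T.extend hT).space i ⊤ := by
  rcases i with _ | i <;> exact Submodule.mem_top

end TopFunctor

/-! ### The equivalence for an extendable equipped poset. -/

namespace IsExtendable

variable {K P A : Type u} [Field K] [PartialOrder P] [Fintype P] [DecidableEq P] [Ring A]
  [Algebra K A] {T : MultSystem K P A} {ε : WithTop P → A} (h : IsExtendable T ε)

theorem isFull : IsFull h.topSystem ε :=
  h.topSystem.exists_sum_mul_mul_eq_one ε h.admissible h.idem h.admissible.one_ne_zero h.mem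
    h.morita

theorem functor_faithful : h.functor.Faithful where
  map_injective {L M f g} hfg := by
    refine (topFunctor T h.one_mem).map_injective ?_
    exact h.isFull.cutMap_uMap_injective h.idem h.mem
      (L := (topFunctor T h.one_mem).obj L) (M := (topFunctor T h.one_mem).obj M) rfl
      (congrArg ModuleCat.Hom.hom hfg)

theorem functor_full : h.functor.Full where
  map_surjective {L M} g := by
    obtain ⟨f, hf⟩ := h.isFull.exists_cutMap_uMap_eq h.idem h.mem
      (L := (topFunctor T h.one_mem).obj L) (M := (topFunctor T h.one_mem).obj M) g.hom
      (extend_space_top T h.one_mem) rfl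
    obtain ⟨f, rfl⟩ := (topFunctor T h.one_mem).map_surjective f
    exact ⟨f, ModuleCat.hom_ext hf⟩

theorem socleProjective_functor_obj (L : Rep T) :
    socleProjective h.admissibleSystem.Inc (h.functor.obj L) :=
  MultSystem.TopSeparated.projective_socle h.admissible
    (h.isFull.topSeparated h.idem h.mem (extend_space_top T h.one_mem) _)

theorem exists_functor_obj_iso (X : ModuleCat.{u} (h.admissibleSystem.Inc)ᵐᵒᵖ)
    (hX : socleProjective h.admissibleSystem.Inc X) :
    ∃ L : Rep T, Nonempty (h.functor.obj L ≅ X) := by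
  have hX' := MultSystem.topSeparated_of_projective_socle h.admissible hX
  let e := LinearEquiv.ofBijective
    (coindUnit h.idem h.mem X (extend_space_top T h.one_mem) fun _ => rfl)
    ⟨coindUnit_injective _ _ hX', coindUnit_surjective _ _⟩
  -- The coinduced representation lives on `P^m`; as its subspace at `⊤` is the whole module, it
  -- comes from a representation on `P`.
  obtain ⟨i⟩ := nonempty_topFunctor_obj_restrictTop_iso T h.one_mem
    (coindRep h.idem h.mem X fun _ => rfl) Coind.sub_top
  exact ⟨_, ⟨(uFunctor h.topSystem ⋙ cutFunctor (h.topSystem.cornerIncl ε h.idem h.mem)).mapIso i ≪≫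
    e.toModuleIso.symm⟩⟩

end IsExtendable

end EquippedPoset

theorem mainTheorem1 {K P A : Type u} [Field K] [PartialOrder P] [Fintype P] [DecidableEq P]
    [Ring A] [Algebra K A] (T : EquippedPoset.MultSystem K P A) (ε : WithTop P → A)
    (h : EquippedPoset.IsExtendable T ε) :
    ∃ hU : ∀ L : EquippedPoset.Rep T,
        EquippedPoset.socleProjective h.admissibleSystem.Inc (h.functor.obj L),
      ((EquippedPoset.socleProjective h.admissibleSystem.Inc).lift h.functor hU).IsEquivalence := by
  refine ⟨h.socleProjective_functor_obj, ?_⟩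
  have := h.functor_faithful
  have := h.functor_full
  exact
    { essSurj := ⟨fun X => by
        obtain ⟨L, ⟨i⟩⟩ := h.exists_functor_obj_iso X.obj X.property
        exact ⟨L, ⟨(EquippedPoset.socleProjective h.admissibleSystem.Inc).isoMk i⟩⟩⟩ }
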